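/- **Setting.** Fix real numbers $\mu_h,\mu_\ell,b,c$ with $b>0$ and $\mu_h+\mu_\ell<c$. Let $(A_{h,i}(t))_{t\in\mathbb R}$ and $(A_{\ell,i}(t))_{t\in\mathbb R}$, $i\ge 1$, be mutually independent Gaussian processes with (almost surely) continuous paths, stationary increments and $A_{h,i}(0)=A_{\ell,i}(0)=0$, such that for $j\in\{h,\ell\}$, all $i$ and all $s\le t$ $$\mathbb E A_{j,i}(t)=\mu_j t,\qquad \operatorname{Var}\big(A_{j,i}(t)-A_{j,i}(s)\big)=v_j(t-s),$$ where $\lim_{t\to\infty}v_j(t)/t^{\alpha_j}=0$ for some $\alpha_j<2$. Write $A_{j,i}(s,t):=A_{j,i}(t)-A_{j,i}(s)$. In the priority system with link capacity $nc$, fed by the high-priority sources $A_{h,1},\dots,A_{h,n}$ and the low-priority sources $A_{\ell,1},\dots,A_{\ell,n}$, the high-priority class is served as if it were alone and the total content is that of a single queue fed by all sources; so the stationary content of the low-priority queue is $$Q_{\ell,n}=\sup_{t>0}\Big(\sum_{i=1}^n\big(A_{h,i}(-t,0)+A_{\ell,i}(-t,0)\big)-nct\Big)-\sup_{s>0}\Big(\sum_{i=1}^nA_{h,i}(-s,0)-ncs\Big)$$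 (as an extended real number, with $\infty-\infty:=-\infty$). Let $$J_p:=\liminf_{n\to\infty}\,-\frac1n\log\mathbb P(Q_{\ell,n}>nb)\in[0,\infty]$$ be the decay rate of the low-priority overflow probability (it equals the limit whenever the limit exists; $\log 0:=-\infty$). Let $\Omega$ be the set of continuous $\omega:\mathbb R\to\mathbb R$ with $\omega(0)=0$ and $\lim_{t\to\pm\infty}\omega(t)/(1+|t|)=0$. For $j\in\{h,\ell\}$ let $\Gamma_j(s,t)=\tfrac12\big(v_j(|s|)+v_j(|t|)-v_j(|t-s|)\big)$ for $s,t\in\mathbb R$, and let $R_j$ be the reproducing kernel Hilbert space of $\Gamma_j$, that is, the completion, as a space of functions on $\mathbb R$, of the span of the functions $\Gamma_j(s,\cdot)$ with $\langle\Gamma_j(s,\cdot),\Gamma_j(t,\cdot)\rangle_{R_j}=\Gamma_j(s,t)$. For a pair $f=(f_h,f_\ell)$ of functions $\mathbb R\to\mathbb R$ put $\bar f_h(t):=f_h(t)-\mu_ht$, $\bar f_\ell(t):=f_\ell(t)-\mu_\ell t$ and $$I(f):=\tfrac12\|\bar f_h\|_{R_h}^2+\tfrac12\|\bar f_\ell\|_{R_\ell}^2,$$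 where $\|\omega\|_{R_j}:=\infty$ if $\omega\notin R_j$. For $s,t>0$ let $$\mathcal U_p^{s,t}:=\left\{(f_h,f_\ell):\ \bar f_h,\bar f_\ell\in\Omega,\ \ -f_h(-t)-f_\ell(-t)\ge b+ct,\ \ f_h(-s)-f_h(-t)-f_\ell(-t)\ge b+c(t-s)\right\}.$$ **Theorem.** $$J_p\ \ge\ \inf_{t>0}\ \sup_{s>0}\ \inf_{f\in\mathcal U_p^{s,t}}I(f),$$ with the infimum of the empty set equal to $+\infty$. -/

import Mathlib

open MeasureTheory ProbabilityTheory Filter Topology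
open scoped ENNReal

noncomputable section

namespace PriorityQueue

/-- `A` is a Gaussian source on the probability space `(Ω, P)` with mean rate `m` and variance
function `v`: a two-sided Gaussian process started at `0` (`A t - A s` is the traffic offered in
`(s, t]`), with almost surely continuous paths, with means `E A(t) = m t`, and with stationary
increments, `Var (A t - A s) = v (t - s)` for `s ≤ t` (for a Gaussian process with `A 0 = 0` and
linear mean this is equivalent to stationarity of the increments in law with variance function
`v`).  The variance function grows slower than some power `t ^ α` with `α < 2`.  Only the values
of `v` on `[0, ∞)` matter. -/
structure IsGaussianSource {Ω : Type*} [MeasurableSpace Ω] (P : Measure Ω)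
    (A : ℝ → Ω → ℝ) (m : ℝ) (v : ℝ → ℝ) : Prop where
  measurable : ∀ t, Measurable (A t)
  isGaussian : IsGaussianProcess A P
  zero : ∀ᵐ ω ∂P, A 0 ω = 0
  continuous : ∀ᵐ ω ∂P, Continuous fun t => A t ω
  mean : ∀ t, ∫ ω, A t ω ∂P = m * t
  variance : ∀ s t, s ≤ t → Var[fun ω => A t ω - A s ω; P] = v (t - s)
  growth : ∃ α : ℝ, α < 2 ∧ Tendsto (fun t : ℝ => v t / t ^ α) atTop (𝓝 0)

/-- The path space: continuous `w : ℝ → ℝ` with `w 0 = 0` and `w t / (1 + |t|) → 0` as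
`t → ± ∞`. -/
def pathSpace : Set (ℝ → ℝ) :=
  {w | Continuous w ∧ w 0 = 0 ∧
    Tendsto (fun t => w t / (1 + |t|)) atTop (𝓝 0) ∧
    Tendsto (fun t => w t / (1 + |t|)) atBot (𝓝 0)}

/-- The covariance `Γ(s, t)` at times `s, t ∈ ℝ` of a centered process with stationary increments,
value `0` at time `0` and variance function `v`. -/
def cov (v : ℝ → ℝ) (s t : ℝ) : ℝ := (v |t| - v |t - s| + v |s|) / 2

/-- The covariance function as a kernel, in the form used by Mathlib's reproducing kernel
Hilbert spaces of real functions on `ℝ`. -/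
def covKernel (v : ℝ → ℝ) : Matrix ℝ ℝ (ℝ →L[ℝ] ℝ) :=
  Matrix.of fun s t => cov v s t • ContinuousLinearMap.id ℝ ℝ

open scoped Classical in
/-- The rate function of a centered path `w`: `‖w‖² / 2`, with the norm of the reproducing kernel
Hilbert space `R` of the covariance function (the completion of the span of the functions
`Γ(s, ·)` under `⟨Γ(s, ·), Γ(t, ·)⟩ = Γ(s, t)`), if `w ∈ R`, and `∞` if `w ∉ R`.  The infimum is
over the elements of `R` that are equal to `w` as functions, of which there is at most one.
The kernel is positive semidefinite whenever `v` is the variance function of a Gaussian source, so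
the last case does not arise for these. -/
def rate (v : ℝ → ℝ) (w : ℝ → ℝ) : ℝ≥0∞ :=
  if h : (covKernel v).PosSemidef then
    haveI : Fact (covKernel v).PosSemidef := ⟨h⟩
    ⨅ (g : RKHS.OfKernel (covKernel v)) (_ : (⇑g : ℝ → ℝ) = w), ENNReal.ofReal (‖g‖ ^ 2 / 2)
  else ⊤

/-- The centered version `t ↦ f t - m t` of a path with drift `m`. -/
def centered (m : ℝ) (f : ℝ → ℝ) : ℝ → ℝ := fun t => f t - m * t

/-- The rate function `I(f)` of a pair `f = (f_h, f_ℓ)` of (non-centered) paths. -/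
def pairRate (vh vl : ℝ → ℝ) (mh ml : ℝ) (f : (ℝ → ℝ) × (ℝ → ℝ)) : ℝ≥0∞ :=
  rate vh (centered mh f.1) + rate vl (centered ml f.2)

/-- The set `U_p^{s,t}` of pairs of paths (whose centered versions lie in the path space). -/
def overflowSet (mh ml b c s t : ℝ) : Set ((ℝ → ℝ) × (ℝ → ℝ)) :=
  {f | centered mh f.1 ∈ pathSpace ∧ centered ml f.2 ∈ pathSpace ∧
    b + c * t ≤ -f.1 (-t) - f.2 (-t) ∧
    b + c * (t - s) ≤ f.1 (-s) - f.1 (-t) - f.2 (-t)}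

variable {Ω : Type*}

/-- The stationary content at time `0` of a queue that is fed by the sources `A 0, …, A (n-1)` and
drained at rate `n c`, that is `sup_{s > 0} (∑_{i < n} A_i(-s, 0) - n c s)`. -/
def queue (A : ℕ → ℝ → Ω → ℝ) (c : ℝ) (n : ℕ) (ω : Ω) : EReal :=
  ⨆ (s : ℝ) (_ : 0 < s),
    ((∑ i ∈ Finset.range n, (A i 0 ω - A i (-s) ω) - n * c * s : ℝ) : EReal)

/-- The stationary content of the low-priority queue, fed by `Al 0, …, Al (n-1)`, when the
high-priority sources are `Ah 0, …, Ah (n-1)` and the link has capacity `n c`.  The high-priority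
class does not see the low-priority class, so the high-priority queue is the queue fed by `Ah`
alone; the system is work-conserving, so the total content is that of the queue fed by both
classes; the low-priority content is the difference. -/
def lowQueue (Ah Al : ℕ → ℝ → Ω → ℝ) (c : ℝ) (n : ℕ) (ω : Ω) : EReal :=
  queue (fun i t ω => Ah i t ω + Al i t ω) c n ω - queue Ah c n ω

/-- The exponential decay rate `- lim (1/n) log P(Q_{ℓ,n} > n b)` of the low-priority overflow
probability.  It is written as a lower limit in the extended reals, which is the limit whenever
the limit exists (with `log 0 = -∞`), so that lower bounds for it do not presuppose that. -/
def lowDecayRate [MeasurableSpace Ω] (P : Measure Ω) (Ah Al : ℕ → ℝ → Ω → ℝ) (b c : ℝ) : EReal :=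
  liminf (fun n : ℕ =>
    -(ENNReal.log (P {ω | ((n * b : ℝ) : EReal) < lowQueue Ah Al c n ω})) / (n : EReal)) atTop

end PriorityQueue

end

namespace PriorityQueue

/-! ### Second-order structure of a single source -/

section Source

variable {Ω : Type*} [MeasurableSpace Ω] {P : Measure Ω} {A : ℝ → Ω → ℝ} {m : ℝ} {v : ℝ → ℝ}

/-! It suffices to bound the overflow probability by `C * exp (-n K)` for each nonnegative `K`
strictly below the inf-sup-inf (`exists_measure_lowQueue_le`). No large deviation principle on path
space is needed: Chernoff bounds at two times, finite-dimensional duality and compactness in `t` do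
the work.

Overflow forces some `t > 0` at which the total content exceeds `n b`, and also `n b` plus every
term of the high-priority supremum (`ae_exists_lowOverflowAt`). For fixed `t`, choose `s` so that
the rate on `U_p^{s,t}` exceeds `K`. Keeping only this `s` leaves two linear constraints on the
sources at `-s` and `-t`, and Chernoff bounds a nonnegative combination of them. The best Chernoff
exponent is the dual of minimizing the rate over combinations of covariance functions; if no
exponent exceeded `K`, duality would yield an admissible path of rate at most `K`
(`exists_feasible_of_dual_le`, `exists_multipliers`).

The estimate at `t` extends to a neighbourhood of `t` with the same `s` and multipliers, because
over short lags the averaged sources oscillate by more than any given amount only with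
superexponentially small probability. This rests on Fernique's theorem and path continuity
(`exists_measure_osc_le`). The same fact and `b > 0` handle `t` near `0`. Large `t` are negligible
since the variance grows more slowly than a power below `2` while the constraint grows linearly
(`exists_measure_tail_le`). Compactness of `[0, T]` leaves finitely many neighbourhoods. -/

lemma IsGaussianSource.memLp_two (hA : IsGaussianSource P A m v) (t : ℝ) : MemLp (A t) 2 P :=
  (hA.isGaussian.hasGaussianLaw_eval t).memLp_two

lemma IsGaussianSource.integrable (hA : IsGaussianSource P A m v) (t : ℝ) :
    Integrable (A t) P :=
  (hA.isGaussian.hasGaussianLaw_eval t).integrable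

lemma IsGaussianSource.variance_sub_eq (hA : IsGaussianSource P A m v) (s t : ℝ) :
    Var[fun ω => A t ω - A s ω; P] = v |t - s| := by
  rcases le_total s t with h | h
  · rw [hA.variance s t h, abs_of_nonneg (sub_nonneg.2 h)]
  · rw [abs_sub_comm, abs_of_nonneg (sub_nonneg.2 h), ← hA.variance t s h, ← variance_neg]
    congr 1
    ext ω
    simp

lemma IsGaussianSource.variance_eq (hA : IsGaussianSource P A m v) (t : ℝ) :
    Var[A t; P] = v |t| := by
  have h := hA.variance_sub_eq 0 t
  rw [sub_zero] at h
  rw [← h]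
  refine variance_congr ?_
  filter_upwards [hA.zero] with ω hω
  simp [hω]

lemma IsGaussianSource.variance_nonneg (hA : IsGaussianSource P A m v) (t : ℝ) : 0 ≤ v |t| :=
  hA.variance_eq t ▸ ProbabilityTheory.variance_nonneg _ _

lemma IsGaussianSource.variance_zero (hA : IsGaussianSource P A m v) : v 0 = 0 := by
  have h := hA.variance_sub_eq 0 0
  simp only [sub_self, abs_zero] at h
  rw [← h]
  exact ProbabilityTheory.variance_zero P

lemma IsGaussianSource.covariance_eq (hA : IsGaussianSource P A m v) (s t : ℝ) :
    cov[A s, A t; P] = cov v s t := by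
  have := hA.isGaussian.isProbabilityMeasure
  have h := variance_fun_sub (hA.memLp_two t) (hA.memLp_two s)
  rw [hA.variance_sub_eq, hA.variance_eq, hA.variance_eq, covariance_comm] at h
  unfold cov
  linarith

lemma cov_self (v : ℝ → ℝ) (h0 : v 0 = 0) (t : ℝ) : cov v t t = v |t| := by
  simp [cov, h0]

lemma cov_comm (v : ℝ → ℝ) (s t : ℝ) : cov v s t = cov v t s := by
  rw [cov, cov, abs_sub_comm]
  ring

/-- The exponential moment of a linear combination of two values of a Gaussian source. -/
lemma IsGaussianSource.lintegral_exp (hA : IsGaussianSource P A m v) (s t x y : ℝ) :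
    ∫⁻ ω, ENNReal.ofReal (Real.exp (x * A s ω + y * A t ω)) ∂P =
      ENNReal.ofReal (Real.exp ((x * s + y * t) * m +
        (x ^ 2 * cov v s s + 2 * x * y * cov v s t + y ^ 2 * cov v t t) / 2)) := by
  have := hA.isGaussian.isProbabilityMeasure
  set L : ℝ × ℝ →L[ℝ] ℝ := x • ContinuousLinearMap.fst ℝ ℝ ℝ + y • ContinuousLinearMap.snd ℝ ℝ ℝ
  have hG : HasGaussianLaw (fun ω => x * A s ω + y * A t ω) P := by
    have := (hA.isGaussian.hasGaussianLaw_prodMk (s := s) (t := t)).map_fun L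
    simpa [L] using this
  have hi : Integrable (fun ω => Real.exp (x * A s ω + y * A t ω)) P := by
    have := integrable_exp_mul_gaussianReal (μ := P[fun ω => x * A s ω + y * A t ω])
      (v := Var[fun ω => x * A s ω + y * A t ω; P].toNNReal) 1
    rw [← hG.map_eq_gaussianReal, integrable_map_measure (by fun_prop) hG.aemeasurable] at this
    simpa [Function.comp_def] using this
  rw [← ofReal_integral_eq_lintegral_ofReal hi (ae_of_all _ fun _ => (Real.exp_pos _).le)]
  have hm := mgf_gaussianReal hG.map_eq_gaussianReal 1
  simp only [mgf, one_mul, mul_one, one_pow] at hm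
  rw [hm, Real.coe_toNNReal _ (ProbabilityTheory.variance_nonneg _ _)]
  have hmean : ∫ ω, (x * A s ω + y * A t ω) ∂P = (x * s + y * t) * m := by
    rw [integral_add ((hA.integrable s).const_mul x) ((hA.integrable t).const_mul y),
      integral_const_mul, integral_const_mul, hA.mean, hA.mean]
    ring
  have hvar : Var[fun ω => x * A s ω + y * A t ω; P] =
      x ^ 2 * cov v s s + 2 * x * y * cov v s t + y ^ 2 * cov v t t := by
    rw [variance_fun_add ((hA.memLp_two s).const_mul x) ((hA.memLp_two t).const_mul y),
      variance_const_mul, variance_const_mul, covariance_const_mul_left,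
      covariance_const_mul_right, hA.covariance_eq, ← covariance_self (hA.memLp_two s).aemeasurable,
      ← covariance_self (hA.memLp_two t).aemeasurable, hA.covariance_eq, hA.covariance_eq]
    ring
  rw [hmean, hvar]

/-- The quadratic form of the kernel is the variance of a linear combination of source values. This
excludes the default value `⊤` in `rate`. -/
lemma IsGaussianSource.posSemidef (hA : IsGaussianSource P A m v) :
    (covKernel v).PosSemidef := by
  have := hA.isGaussian.isProbabilityMeasure
  have htfae := (RKHS.posSemidef_tfae (𝕜 := ℝ) (K := covKernel v)).out 0 2
  refine htfae.2 ⟨?_, fun f => ?_⟩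
  · have hstar : star (ContinuousLinearMap.id ℝ ℝ) = ContinuousLinearMap.id ℝ ℝ :=
      star_one (ℝ →L[ℝ] ℝ)
    ext s t
    simp [hstar, covKernel, Matrix.conjTranspose_apply, cov_comm v s t]
  · have h : Var[fun ω => ∑ t ∈ f.support, f t * A t ω; P] =
        ∑ s ∈ f.support, ∑ t ∈ f.support, f s * (f t * cov v s t) := by
      rw [variance_fun_sum' fun t _ => (hA.memLp_two t).const_mul (f t)]
      simp_rw [covariance_const_mul_left, covariance_const_mul_right, hA.covariance_eq]
    have h0 := ProbabilityTheory.variance_nonneg (fun ω => ∑ t ∈ f.support, f t * A t ω) P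
    rw [h] at h0
    convert h0 using 1
    simp only [Finsupp.sum, covKernel, Matrix.of_apply, RCLike.re_to_real]
    refine Finset.sum_congr rfl fun s _ => Finset.sum_congr rfl fun t _ => ?_
    simp [cov_comm v s t]
    ring

end Source

/-! ### Gaussian laws from means and covariances -/

section Law

variable {Ω : Type*} [MeasurableSpace Ω] {P : Measure Ω} {T : Type*}

open scoped Classical in
lemma strongDual_restrict (I : Finset T) (L : StrongDual ℝ (I → ℝ)) (x : T → ℝ) :
    L (I.restrict x) = ∑ i : I, L.comp (ContinuousLinearMap.single ℝ (fun _ => ℝ) i) 1 * x i := by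
  rw [← L.sum_comp_single]
  refine Finset.sum_congr rfl fun i _ => ?_
  have h := (L.comp (ContinuousLinearMap.single ℝ (fun _ => ℝ) i)).map_smul (x i) 1
  rw [smul_eq_mul, smul_eq_mul, mul_one] at h
  rw [mul_comm, ← h]
  rfl

/-- The law of a Gaussian process is determined by its mean and covariance functions. -/
lemma map_eq_of_isGaussianProcess {X Y : T → Ω → ℝ}
    (hX : IsGaussianProcess X P) (hY : IsGaussianProcess Y P)
    (mX : ∀ t, Measurable (X t)) (mY : ∀ t, Measurable (Y t))
    (hmean : ∀ t, ∫ ω, X t ω ∂P = ∫ ω, Y t ω ∂P)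
    (hcov : ∀ s t, cov[X s, X t; P] = cov[Y s, Y t; P]) :
    P.map (fun ω t => X t ω) = P.map (fun ω t => Y t ω) := by
  classical
  have := hX.isProbabilityMeasure
  rw [map_eq_iff_forall_finset_map_restrict_eq (measurable_pi_lambda _ mX).aemeasurable
    (measurable_pi_lambda _ mY).aemeasurable]
  intro I
  have hXm : Measurable fun ω => I.restrict (X · ω) := measurable_pi_lambda _ fun t => mX t
  have hYm : Measurable fun ω => I.restrict (Y · ω) := measurable_pi_lambda _ fun t => mY t
  have := Measure.isProbabilityMeasure_map (μ := P) hXm.aemeasurable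
  have := Measure.isProbabilityMeasure_map (μ := P) hYm.aemeasurable
  refine Measure.ext_of_charFunDual ?_
  ext L
  rw [(hX.hasGaussianLaw I).charFunDual_map_eq_fun, (hY.hasGaussianLaw I).charFunDual_map_eq_fun]
  simp_rw [strongDual_restrict]
  have iX : ∀ i : I, MemLp (X i) 2 P := fun i => (hX.hasGaussianLaw_eval _).memLp_two
  have iY : ∀ i : I, MemLp (Y i) 2 P := fun i => (hY.hasGaussianLaw_eval _).memLp_two
  rw [variance_fun_sum fun i => (iX i).const_mul _, variance_fun_sum fun i => (iY i).const_mul _,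
    integral_finsetSum _ fun i _ => ((iX i).integrable (by norm_num)).const_mul _,
    integral_finsetSum _ fun i _ => ((iY i).integrable (by norm_num)).const_mul _]
  simp_rw [covariance_const_mul_left, covariance_const_mul_right, integral_const_mul, hcov, hmean]

end Law

/-! ### Exponential moments of bounded Gaussian suprema -/

section Fernique

variable {Ω : Type*} [MeasurableSpace Ω] {P : Measure Ω} {T : Type*}

/-- **Fernique's theorem** for an almost surely bounded centered Gaussian process with countable
index set: its supremum has Gaussian moments of some positive order. -/
lemma exists_lintegral_iSup_exp_sq_lt_top [Countable T] {X : T → Ω → ℝ}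
    (hX : IsGaussianProcess X P) (mX : ∀ t, Measurable (X t)) (hmean : ∀ t, ∫ ω, X t ω ∂P = 0)
    (hbdd : ∀ᵐ ω ∂P, ∃ C : ℝ, ∀ t, |X t ω| ≤ C) :
    ∃ K : ℝ, 0 < K ∧ ∫⁻ ω, ⨆ t, ENNReal.ofReal (Real.exp (K * X t ω ^ 2)) ∂P < ⊤ := by
  classical
  have := hX.isProbabilityMeasure
  -- Almost sure boundedness puts most of the mass in one ball. Any level strictly between `1/2` and
  -- `1` would serve in place of `3/4`.
  obtain ⟨N, hN0, hN⟩ : ∃ N : ℕ, 0 < N ∧ (3 / 4 : ℝ≥0∞) < P {ω | ∀ t, |X t ω| ≤ N} := by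
    have hmono : Monotone fun N : ℕ => {ω | ∀ t, |X t ω| ≤ N} := fun a b hab ω hω t =>
      (hω t).trans (by exact_mod_cast hab)
    have hlim := tendsto_measure_iUnion_atTop (μ := P) hmono
    have huniv : P (⋃ N : ℕ, {ω | ∀ t, |X t ω| ≤ N}) = 1 := by
      rw [← measure_univ (μ := P)]
      refine measure_congr (eventuallyEq_univ.2 ?_)
      filter_upwards [hbdd] with ω ⟨C, hC⟩
      obtain ⟨N, hN⟩ := exists_nat_ge C
      exact Set.mem_iUnion.2 ⟨N, fun t => (hC t).trans hN⟩
    rw [huniv] at hlim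
    have h34 : (3 / 4 : ℝ≥0∞) < 1 := by
      rw [ENNReal.div_lt_iff] <;> norm_num
    obtain ⟨N, h1, h2⟩ := ((hlim.eventually (lt_mem_nhds h34)).and (eventually_gt_atTop 0)).exists
    exact ⟨N, h2, h1⟩
  have hc_gt : (2⁻¹ : ℝ≥0∞) < 3 / 4 := by
    rw [← one_div, ENNReal.div_lt_iff (by norm_num) (by norm_num), ENNReal.mul_div_right_comm.symm,
      ENNReal.lt_div_iff_mul_lt] <;> norm_num
  have hc_lt : (3 / 4 : ℝ≥0∞) < 1 := by
    rw [ENNReal.div_lt_iff] <;> norm_num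
  set c : ℝ≥0∞ := 3 / 4 with hc
  have hNpos : (0 : ℝ) < N := by exact_mod_cast hN0
  set K : ℝ := Fernique.logRatio c * (N : ℝ)⁻¹ ^ 2 with hK
  have hKpos : 0 < K := mul_pos (Fernique.logRatio_pos hc_gt hc_lt) (by positivity)
  set B : ℝ≥0∞ := .ofReal (Real.exp (Fernique.logRatio c))
        + ∑' n : ℕ, .ofReal (Real.exp (-2⁻¹ * Real.log (c / (1 - c)).toReal * 2 ^ n)) with hB
  refine ⟨K, hKpos, ?_⟩
  -- The bound `B` depends only on the mass level, not on `I`, so it survives the passage to the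
  -- countable supremum by monotone convergence.
  have hfin : ∀ I : Finset T,
      ∫⁻ ω, ENNReal.ofReal (Real.exp (K * ‖(I.restrict (X · ω) : I → ℝ)‖ ^ 2)) ∂P ≤ B := by
    intro I
    have hm : Measurable fun ω => (I.restrict (X · ω) : I → ℝ) :=
      measurable_pi_lambda _ fun t => mX t
    have hg := (hX.hasGaussianLaw I).isGaussian_map
    have hp := Measure.isProbabilityMeasure_map (μ := P) hm.aemeasurable
    have hrot := IsGaussian.map_rotation_eq_self_of_forall_strongDual_eq_zero
      (μ := P.map fun ω => (I.restrict (X · ω) : I → ℝ)) (fun L => by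
        rw [integral_map hm.aemeasurable (by fun_prop)]
        simp_rw [strongDual_restrict]
        rw [integral_finsetSum]
        · simp [integral_const_mul, hmean]
        · exact fun i _ => (hX.hasGaussianLaw_eval (i : T)).integrable.const_mul _) (-(Real.pi / 4))
    have hmass : c ≤ (P.map fun ω => (I.restrict (X · ω) : I → ℝ)) {x | ‖x‖ ≤ (N : ℝ)} := by
      rw [Measure.map_apply hm (measurableSet_le measurable_norm measurable_const)]
      refine hN.le.trans (measure_mono fun ω hω => ?_)
      exact (pi_norm_le_iff_of_nonneg hNpos.le).2 fun i => hω i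
    have h := lintegral_exp_mul_sq_norm_le_of_map_rotation_eq_self hrot hmass hc_gt
    rwa [lintegral_map (by fun_prop) hm] at h
  have hBtop : B < ⊤ := by
    rw [hB]
    refine ENNReal.add_lt_top.2 ⟨ENNReal.ofReal_lt_top, ?_⟩
    set a : ℝ := 2⁻¹ * Real.log (c / (1 - c)).toReal with ha
    have hone : 1 - c ≠ 0 := (tsub_pos_iff_lt.2 hc_lt).ne'
    have hone' : 1 - c < c := by
      refine lt_of_le_of_lt (tsub_le_iff_right.2 ?_) hc_gt
      exact ENNReal.inv_two_add_inv_two.ge.trans (add_le_add_right hc_gt.le _)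
    have ha_pos : 0 < a := by
      refine mul_pos (by norm_num) (Real.log_pos ?_)
      rw [← ENNReal.toReal_one]
      refine (ENNReal.toReal_lt_toReal (by norm_num)
        (ENNReal.div_lt_top (hc_lt.trans (by norm_num)).ne hone).ne).2 ?_
      rw [ENNReal.lt_div_iff_mul_lt (Or.inl hone) (Or.inl (by finiteness))]
      simpa using hone'
    have hsum : Summable fun n : ℕ => Real.exp (-a * 2 ^ n) := by
      refine Summable.of_nonneg_of_le (fun _ => (Real.exp_pos _).le) (fun n => ?_)
        (summable_geometric_of_lt_one (Real.exp_pos (-a)).le (by simpa using ha_pos))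
      rw [← Real.exp_nat_mul]
      refine Real.exp_le_exp.2 ?_
      have : (n : ℝ) ≤ 2 ^ n := by exact_mod_cast n.lt_two_pow_self.le
      nlinarith
    have := hsum.tsum_ofReal_lt_top
    simpa [ha] using this
  refine lt_of_le_of_lt ?_ hBtop
  calc ∫⁻ ω, ⨆ t, ENNReal.ofReal (Real.exp (K * X t ω ^ 2)) ∂P
      ≤ ∫⁻ ω, ⨆ I : Finset T,
          ENNReal.ofReal (Real.exp (K * ‖(I.restrict (X · ω) : I → ℝ)‖ ^ 2)) ∂P := by
        refine lintegral_mono fun ω => iSup_le fun t => ?_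
        refine le_iSup_of_le {t} ?_
        refine ENNReal.ofReal_le_ofReal (Real.exp_le_exp.2 ?_)
        refine mul_le_mul_of_nonneg_left ?_ hKpos.le
        rw [← sq_abs]
        refine pow_le_pow_left₀ (abs_nonneg _) ?_ 2
        exact norm_le_pi_norm (({t} : Finset T).restrict (X · ω)) ⟨t, by simp⟩
    _ = ⨆ I : Finset T, ∫⁻ ω,
          ENNReal.ofReal (Real.exp (K * ‖(I.restrict (X · ω) : I → ℝ)‖ ^ 2)) ∂P := by
        refine lintegral_iSup_directed (fun I => ?_) (Monotone.directed_le fun I J hIJ ω => ?_)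
        · have hm : Measurable fun ω => (I.restrict (X · ω) : I → ℝ) :=
            measurable_pi_lambda _ fun t => mX t
          fun_prop
        · refine ENNReal.ofReal_le_ofReal (Real.exp_le_exp.2 ?_)
          refine mul_le_mul_of_nonneg_left ?_ hKpos.le
          refine pow_le_pow_left₀ (norm_nonneg _) ?_ 2
          refine (pi_norm_le_iff_of_nonneg (norm_nonneg _)).2 fun i => ?_
          exact norm_le_pi_norm (J.restrict (X · ω)) ⟨i, hIJ i.2⟩
    _ ≤ B := iSup_le hfin

/-- Completing the square gives `θ |x| ≤ θ ^ 2 / (4 K) + K x ^ 2`, so Gaussian moments dominate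
exponential ones of every order. -/
lemma lintegral_iSup_exp_abs_lt_top [Countable T] {X : T → Ω → ℝ}
    (hX : IsGaussianProcess X P) (mX : ∀ t, Measurable (X t)) (hmean : ∀ t, ∫ ω, X t ω ∂P = 0)
    (hbdd : ∀ᵐ ω ∂P, ∃ C : ℝ, ∀ t, |X t ω| ≤ C) (θ : ℝ) :
    ∫⁻ ω, ⨆ t, ENNReal.ofReal (Real.exp (θ * |X t ω|)) ∂P < ⊤ := by
  obtain ⟨K, hK, h⟩ := exists_lintegral_iSup_exp_sq_lt_top hX mX hmean hbdd
  set E : ℝ≥0∞ := ENNReal.ofReal (Real.exp (θ ^ 2 / (4 * K)))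
  have hle : ∀ ω, ⨆ t, ENNReal.ofReal (Real.exp (θ * |X t ω|)) ≤
      E * ⨆ t, ENNReal.ofReal (Real.exp (K * X t ω ^ 2)) := by
    intro ω
    refine iSup_le fun t => ?_
    refine le_trans ?_ (mul_le_mul_right (le_iSup _ t) E)
    rw [← ENNReal.ofReal_mul (Real.exp_pos _).le, ← Real.exp_add]
    refine ENNReal.ofReal_le_ofReal (Real.exp_le_exp.2 ?_)
    rw [← sq_abs (X t ω)]
    have h4 : θ ^ 2 / (4 * K) + K * |X t ω| ^ 2 - θ * |X t ω| =
        (θ - 2 * K * |X t ω|) ^ 2 / (4 * K) := by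
      field_simp
      ring
    have : 0 ≤ (θ - 2 * K * |X t ω|) ^ 2 / (4 * K) := by positivity
    linarith
  refine (lintegral_mono hle).trans_lt ?_
  rw [lintegral_const_mul' _ _ ENNReal.ofReal_ne_top]
  exact ENNReal.mul_lt_top ENNReal.ofReal_lt_top h

end Fernique

/-! ### Oscillations of a single source -/

section Increments

variable {Ω : Type*} [MeasurableSpace Ω] {P : Measure Ω} {A B : ℝ → Ω → ℝ} {m : ℝ} {v : ℝ → ℝ}

lemma hasGaussianLaw_sub_const {ι : Type*} [Fintype ι] {X : Ω → ι → ℝ}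
    (hX : HasGaussianLaw X P) (c : ι → ℝ) : HasGaussianLaw (fun ω => X ω - c) P := by
  refine ⟨isGaussian_of_map_eq_gaussianReal fun L =>
    ⟨P[L ∘ X] - L c, Var[L ∘ X; P].toNNReal, ?_⟩⟩
  rw [AEMeasurable.map_map_of_aemeasurable (by fun_prop) (hX.aemeasurable.sub_const c),
    ← gaussianReal_map_sub_const, ← (hX.map L).map_eq_gaussianReal,
    AEMeasurable.map_map_of_aemeasurable (by fun_prop) (hX.map L).aemeasurable]
  congr 1
  ext ω
  simp

/-- The centered increments over rational time lags of a process `A` with mean rate `m`, starting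
from time `t`. -/
def increment (A : ℝ → Ω → ℝ) (m t : ℝ) (q : ℚ) (ω : Ω) : ℝ := A (t + q) ω - A t ω - m * q

/-- The exponential moment functional of the oscillation of a path over the lags of size at most
`δ`. -/
noncomputable def oscExp (θ δ : ℝ) (w : ℚ → ℝ) : ℝ≥0∞ :=
  ⨆ q : {q : ℚ // |(q : ℝ)| ≤ δ}, ENNReal.ofReal (Real.exp (θ * |w q|))

/-- Rational lags keep the supremum countable; path continuity later recovers the real lags. -/
lemma measurable_oscExp (θ δ : ℝ) : Measurable (oscExp θ δ) := by
  unfold oscExp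
  fun_prop

lemma IsGaussianSource.measurable_increment (hA : IsGaussianSource P A m v) (t : ℝ) (q : ℚ) :
    Measurable (increment A m t q) :=
  ((hA.measurable _).sub (hA.measurable _)).sub_const _

lemma IsGaussianSource.isGaussianProcess_increment (hA : IsGaussianSource P A m v) (t : ℝ) :
    IsGaussianProcess (increment A m t) P where
  hasGaussianLaw I :=
    hasGaussianLaw_sub_const (((hA.isGaussian.shift t).comp_right ((↑) : ℚ → ℝ)).hasGaussianLaw I)
      fun q : I => m * (q : ℚ)

lemma IsGaussianSource.integral_increment (hA : IsGaussianSource P A m v) (t : ℝ) (q : ℚ) :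
    ∫ ω, increment A m t q ω ∂P = 0 := by
  have := hA.isGaussian.isProbabilityMeasure
  have hi : Integrable (fun ω => A (t + q) ω - A t ω) P := (hA.integrable _).sub (hA.integrable _)
  unfold increment
  rw [integral_sub hi (integrable_const _), integral_sub (hA.integrable _) (hA.integrable _), hA.mean, hA.mean]
  simp
  ring

/-- The base time `t` cancels, which is what makes the later oscillation bounds uniform in `t`. -/
lemma IsGaussianSource.covariance_increment (hA : IsGaussianSource P A m v) (t : ℝ) (q r : ℚ) :
    cov[increment A m t q, increment A m t r; P] = cov v q r := by
  have := hA.isGaussian.isProbabilityMeasure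
  have hi : ∀ q : ℚ, Integrable (fun ω => A (t + q) ω - A t ω) P := fun q =>
    (hA.integrable _).sub (hA.integrable _)
  unfold increment
  rw [covariance_sub_const_left (hi q), covariance_sub_const_right (hi r),
    covariance_fun_sub_fun_sub (hA.memLp_two _) (hA.memLp_two _) (hA.memLp_two _)
      (hA.memLp_two _)]
  simp only [hA.covariance_eq, cov, add_sub_add_left_eq_sub, sub_self, sub_add_cancel_left,
    abs_zero, abs_neg, hA.variance_zero, add_sub_cancel_left]
  ring

/-- The increments of two sources with the same mean rate and variance function, started at
arbitrary times, have the same law. -/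
lemma IsGaussianSource.lintegral_oscExp_eq (hA : IsGaussianSource P A m v)
    (hB : IsGaussianSource P B m v) (θ δ s t : ℝ) :
    ∫⁻ ω, oscExp θ δ (fun q => increment A m s q ω) ∂P =
      ∫⁻ ω, oscExp θ δ (fun q => increment B m t q ω) ∂P := by
  have h := map_eq_of_isGaussianProcess (hA.isGaussianProcess_increment s)
    (hB.isGaussianProcess_increment t) (hA.measurable_increment s) (hB.measurable_increment t)
    (fun q => by rw [hA.integral_increment, hB.integral_increment])
    (fun q r => by rw [hA.covariance_increment, hB.covariance_increment])
  rw [← lintegral_map (measurable_oscExp θ δ) (measurable_pi_lambda _ (hA.measurable_increment s)),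
    h, lintegral_map (measurable_oscExp θ δ) (measurable_pi_lambda _ (hB.measurable_increment t))]

lemma IsGaussianSource.lintegral_oscExp_lt_top (hA : IsGaussianSource P A m v) (θ δ t : ℝ) :
    ∫⁻ ω, oscExp θ δ (fun q => increment A m t q ω) ∂P < ⊤ := by
  refine lintegral_iSup_exp_abs_lt_top
    (X := fun (q : {q : ℚ // |(q : ℝ)| ≤ δ}) ω => increment A m t q ω)
    ((hA.isGaussianProcess_increment t).comp_right Subtype.val)
    (fun q => hA.measurable_increment t q) (fun q => hA.integral_increment t q) ?_ θ
  filter_upwards [hA.continuous] with ω hω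
  have hc : Continuous fun u : ℝ => A (t + u) ω - A t ω - m * u :=
    ((hω.comp (continuous_const.add continuous_id)).sub continuous_const).sub
      (continuous_const.mul continuous_id)
  obtain ⟨C, hC⟩ := (isCompact_Icc (a := -δ) (b := δ)).exists_bound_of_continuousOn hc.continuousOn
  exact ⟨C, fun q => hC q (abs_le.1 q.2)⟩

/-- By path continuity the supremum tends to `1` as the lag range shrinks, and the range `1`
dominates. Uniformity over sources and base times comes from equality of the increment laws. -/
lemma IsGaussianSource.exists_lintegral_oscExp_le (hA : IsGaussianSource P A m v)
    (θ : ℝ) : ∃ δ > 0, ∀ (B : ℝ → Ω → ℝ), IsGaussianSource P B m v → ∀ t : ℝ,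
      ∫⁻ ω, oscExp θ δ (fun q => increment B m t q ω) ∂P ≤ ENNReal.ofReal (Real.exp 1) := by
  have := hA.isGaussian.isProbabilityMeasure
  have hlim : Tendsto (fun k : ℕ =>
      ∫⁻ ω, oscExp θ (1 / ((k : ℝ) + 1)) (fun q => increment A m 0 q ω) ∂P) atTop
      (𝓝 (∫⁻ _, 1 ∂P)) := by
    refine tendsto_lintegral_of_dominated_convergence
      (fun ω => oscExp θ 1 (fun q => increment A m 0 q ω))
      (fun k => (measurable_oscExp _ _).comp (measurable_pi_lambda _ (hA.measurable_increment 0)))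
      (fun k => ae_of_all _ fun ω => ?_) (hA.lintegral_oscExp_lt_top θ 1 0).ne ?_
    · refine iSup_le fun q => ?_
      refine le_iSup (fun q : {q : ℚ // |(q : ℝ)| ≤ 1} =>
        ENNReal.ofReal (Real.exp (θ * |increment A m 0 q ω|))) ⟨q, q.2.trans ?_⟩
      rw [div_le_one (by positivity)]
      linarith [(Nat.cast_nonneg k : (0 : ℝ) ≤ k)]
    · filter_upwards [hA.continuous] with ω hω
      set G : ℝ → ℝ≥0∞ := fun u =>
        ENNReal.ofReal (Real.exp (θ * |A (0 + u) ω - A 0 ω - m * u|)) with hG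
      have hc : Continuous G := by
        have : Continuous fun u : ℝ => A (0 + u) ω :=
          hω.comp (continuous_const.add continuous_id)
        exact ENNReal.continuous_ofReal.comp (by fun_prop)
      have hG0 : G 0 = 1 := by simp [hG]
      refine tendsto_order.2 ⟨fun x hx => Eventually.of_forall fun k => hx.trans_le ?_,
        fun x hx => ?_⟩
      · have h0 : |((0 : ℚ) : ℝ)| ≤ 1 / ((k : ℝ) + 1) := by simp; positivity
        refine le_iSup_of_le ⟨0, h0⟩ ?_
        simp [increment]
      · obtain ⟨y, hy1, hyx⟩ := exists_between hx
        have hev : ∀ᶠ u in 𝓝 0, G u < y := by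
          refine hc.continuousAt.eventually (gt_mem_nhds ?_)
          rwa [hG0]
        obtain ⟨ε, hε, hball⟩ := Metric.eventually_nhds_iff.1 hev
        filter_upwards [(tendsto_one_div_add_atTop_nhds_zero_nat (𝕜 := ℝ)).eventually
          (gt_mem_nhds hε)] with k hk
        refine lt_of_le_of_lt (iSup_le fun q => ?_) hyx
        exact (hball (y := ((q : ℚ) : ℝ))
          (by rw [dist_zero_right, Real.norm_eq_abs]; exact q.2.trans_lt hk)).le
  rw [lintegral_one, measure_univ] at hlim
  have h1 : (1 : ℝ≥0∞) < ENNReal.ofReal (Real.exp 1) := by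
    rw [ENNReal.one_lt_ofReal]
    exact Real.one_lt_exp_iff.2 one_pos
  obtain ⟨k, hk⟩ := (hlim.eventually (gt_mem_nhds h1)).exists
  exact ⟨_, by positivity, fun B hB t => (hB.lintegral_oscExp_eq hA _ _ t 0).trans_le hk.le⟩

/-- The variance function of a source with continuous paths is continuous at `0`. -/
lemma IsGaussianSource.tendsto_variance_zero (hA : IsGaussianSource P A m v) :
    Tendsto (fun t => v |t|) (𝓝 0) (𝓝 0) := by
  have := hA.isGaussian.isProbabilityMeasure
  -- The modulus of the characteristic function sees only the variance, and bounded convergence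
  -- applies to it without any domination of `A t`.
  have hchar : ∀ t, ‖∫ ω, Complex.exp (A t ω * Complex.I) ∂P‖ = Real.exp (-(v |t| / 2)) := by
    intro t
    have h : ∫ ω, Complex.exp (A t ω * Complex.I) ∂P = charFun (P.map (A t)) 1 := by
      rw [charFun_apply_real, integral_map (hA.measurable t).aemeasurable (by fun_prop)]
      simp
    rw [h, (hA.isGaussian.hasGaussianLaw_eval t).map_eq_gaussianReal, charFun_gaussianReal,
      Complex.norm_exp, hA.variance_eq]
    simp [hA.variance_nonneg]
  have hlim : Tendsto (fun t => ∫ ω, Complex.exp (A t ω * Complex.I) ∂P) (𝓝 0)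
      (𝓝 (∫ _, 1 ∂P)) := by
    refine tendsto_integral_filter_of_dominated_convergence (fun _ => 1)
      (Eventually.of_forall fun t => ?_) (Eventually.of_forall fun t => ae_of_all _ fun ω => ?_)
      (integrable_const _) ?_
    · have := hA.measurable t
      exact Measurable.aestronglyMeasurable (by fun_prop)
    · rw [Complex.norm_exp_ofReal_mul_I]
    · filter_upwards [hA.continuous, hA.zero] with ω hω h0
      have hc : Continuous fun t => Complex.exp (A t ω * Complex.I) := by fun_prop
      have := hc.tendsto 0
      simpa [h0] using this
  have h2 := (Real.continuousAt_log (x := 1) one_ne_zero).tendsto.comp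
    (by simpa [hchar] using hlim.norm : Tendsto (fun t => Real.exp (-(v |t| / 2))) (𝓝 0) (𝓝 1))
  simp only [Function.comp_def, Real.log_exp, Real.log_one] at h2
  have h3 := h2.const_mul (-2)
  rw [mul_zero] at h3
  exact h3.congr fun t => by ring

end Increments

/-! ### Chernoff bounds and oscillations for sums of independent sources -/

section Sums

variable {Ω : Type*} [MeasurableSpace Ω] {P : Measure Ω} {m : ℝ} {v : ℝ → ℝ}

/-- The Chernoff bound for a product of independent factors. -/
lemma measure_le_prod_le {ι : Type*} (S : Finset ι) {G : ι → Ω → ℝ≥0∞} (hind : iIndepFun G P)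
    (hG : ∀ i, Measurable (G i)) {κ : ι → ℝ}
    (hκ : ∀ i ∈ S, ∫⁻ ω, G i ω ∂P ≤ ENNReal.ofReal (Real.exp (κ i))) (a : ℝ) :
    P {ω | ENNReal.ofReal (Real.exp a) ≤ ∏ i ∈ S, G i ω} ≤
      ENNReal.ofReal (Real.exp (∑ i ∈ S, κ i - a)) := by
  have h := meas_ge_le_lintegral_div (μ := P) (f := fun ω => ∏ i ∈ S, G i ω)
    (S.measurable_fun_prod fun i _ => hG i).aemeasurable
    (ε := ENNReal.ofReal (Real.exp a)) (by simp [Real.exp_pos]) ENNReal.ofReal_ne_top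
  refine h.trans ?_
  rw [lintegral_prod_eq_prod_lintegral_of_indepFun S G hind hG, Real.exp_sub,
    ENNReal.ofReal_div_of_pos (Real.exp_pos a), Real.exp_sum,
    ENNReal.ofReal_prod_of_nonneg fun i _ => (Real.exp_pos _).le]
  exact ENNReal.div_le_div_right (Finset.prod_le_prod' hκ) _

/-- The Chernoff bound for a sum of independent random variables. -/
lemma measure_le_sum_le {ι : Type*} (S : Finset ι) {Y : ι → Ω → ℝ} (hind : iIndepFun Y P)
    (hY : ∀ i, Measurable (Y i)) {κ : ι → ℝ}
    (hκ : ∀ i ∈ S, ∫⁻ ω, ENNReal.ofReal (Real.exp (Y i ω)) ∂P ≤ ENNReal.ofReal (Real.exp (κ i)))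
    (a : ℝ) :
    P {ω | a ≤ ∑ i ∈ S, Y i ω} ≤ ENNReal.ofReal (Real.exp (∑ i ∈ S, κ i - a)) := by
  refine (measure_mono fun ω (hω : a ≤ _) => ?_).trans
    (measure_le_prod_le S (G := fun i ω => ENNReal.ofReal (Real.exp (Y i ω)))
      (hind.comp (fun _ x => ENNReal.ofReal (Real.exp x)) fun _ => by fun_prop)
      (fun i => by have := hY i; fun_prop) hκ a)
  change ENNReal.ofReal (Real.exp a) ≤ ∏ i ∈ S, ENNReal.ofReal (Real.exp (Y i ω))
  rw [← ENNReal.ofReal_prod_of_nonneg fun i _ => (Real.exp_pos _).le, ← Real.exp_sum]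
  exact ENNReal.ofReal_le_ofReal (Real.exp_le_exp.2 hω)

variable {A : ℕ → ℝ → Ω → ℝ}

/-- The oscillation near time `t` of the sum of `n` independent sources. -/
lemma measure_osc_le (hA : ∀ i, IsGaussianSource P (A i) m v)
    (hind : iIndepFun (fun i ω t => A i t ω) P) {θ δ κ t : ℝ} (hθ : 0 ≤ θ)
    (hκ : ∀ i, ∫⁻ ω, oscExp θ δ (fun q => increment (A i) m t q ω) ∂P ≤
      ENNReal.ofReal (Real.exp κ)) (n : ℕ) (η : ℝ) :
    P {ω | ∃ u, |u| < δ ∧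
        n * η < |∑ i ∈ Finset.range n, (A i (t + u) ω - A i t ω - m * u)|} ≤
      ENNReal.ofReal (Real.exp (n * (κ - θ * η))) := by
  have hfun : ∀ i : ℕ, Measurable fun (w : ℝ → ℝ) =>
      oscExp θ δ fun q : ℚ => w (t + q) - w t - m * q := fun i =>
    (measurable_oscExp θ δ).comp (measurable_pi_lambda _ fun q => by fun_prop)
  have h := measure_le_prod_le (P := P) (Finset.range n)
    (G := fun i ω => oscExp θ δ (fun q => increment (A i) m t q ω)) (hind.comp _ hfun)
    (fun i => (measurable_oscExp θ δ).comp
      (measurable_pi_lambda _ ((hA i).measurable_increment t))) (κ := fun _ => κ)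
    (fun i _ => hκ i) (θ * (n * η))
  refine le_trans (measure_mono_ae ?_) (h.trans_eq ?_)
  · filter_upwards [ae_all_iff.2 fun i => (hA i).continuous] with ω hω hex
    obtain ⟨u, hu, hη⟩ := hex
    have hc : Continuous fun u : ℝ =>
        ∑ i ∈ Finset.range n, (A i (t + u) ω - A i t ω - m * u) := by
      refine continuous_finsetSum _ fun i _ => ?_
      exact (((hω i).comp (continuous_const.add continuous_id)).sub continuous_const).sub
        (continuous_const.mul continuous_id)
    -- Both inequalities on the lag are strict, so a violating real lag may be replaced by a
    -- rational one.
    obtain ⟨q, hq⟩ := Rat.denseRange_cast (𝕜 := ℝ).exists_mem_open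
      ((isOpen_lt continuous_abs continuous_const).inter (isOpen_lt continuous_const hc.abs))
      ⟨u, hu, hη⟩
    change _ ≤ _
    calc ENNReal.ofReal (Real.exp (θ * (n * η)))
        ≤ ENNReal.ofReal (Real.exp (∑ i ∈ Finset.range n, θ * |increment (A i) m t q ω|)) := by
          refine ENNReal.ofReal_le_ofReal (Real.exp_le_exp.2 ?_)
          rw [← Finset.mul_sum]
          exact mul_le_mul_of_nonneg_left (hq.2.le.trans (Finset.abs_sum_le_sum_abs _ _)) hθ
      _ = ∏ i ∈ Finset.range n, ENNReal.ofReal (Real.exp (θ * |increment (A i) m t q ω|)) := by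
          rw [Real.exp_sum, ENNReal.ofReal_prod_of_nonneg fun i _ => (Real.exp_pos _).le]
      _ ≤ _ := Finset.prod_le_prod' fun i _ =>
          le_iSup (fun q : {q : ℚ // |(q : ℝ)| ≤ δ} =>
            ENNReal.ofReal (Real.exp (θ * |increment (A i) m t q ω|))) ⟨q, hq.1.le⟩
  · congr 2
    simp
    ring

/-- Oscillations over short time lags are superexponentially unlikely. -/
lemma exists_measure_osc_le (hA : ∀ i, IsGaussianSource P (A i) m v)
    (hind : iIndepFun (fun i ω t => A i t ω) P) (K : ℝ) {η : ℝ} (hη : 0 < η) :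
    ∃ δ > 0, ∀ (t : ℝ) (n : ℕ), P {ω | ∃ u, |u| < δ ∧
        n * η < |∑ i ∈ Finset.range n, (A i (t + u) ω - A i t ω - m * u)|} ≤
      ENNReal.ofReal (Real.exp (-(n * K))) := by
  -- With this `θ` and moment bound `exp 1`, the exponent per source is `1 - (|K| + 1) ≤ -K`.
  obtain ⟨δ, hδ, h⟩ := (hA 0).exists_lintegral_oscExp_le ((|K| + 1) / η)
  refine ⟨δ, hδ, fun t n => ?_⟩
  refine (measure_osc_le hA hind (by positivity) (fun i => h (A i) (hA i) t) n η).trans ?_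
  refine ENNReal.ofReal_le_ofReal (Real.exp_le_exp.2 ?_)
  rw [div_mul_cancel₀ _ hη.ne', ← mul_neg]
  exact mul_le_mul_of_nonneg_left (by linarith [le_abs_self K]) (Nat.cast_nonneg n)

end Sums

/-! ### Negligibility of large times -/

section Tail

variable {Ω : Type*} [MeasurableSpace Ω] {P : Measure Ω} {m : ℝ} {v : ℝ → ℝ} {A : ℕ → ℝ → Ω → ℝ}

lemma measure_le_abs_sum_le (hA : ∀ i, IsGaussianSource P (A i) m v)
    (hind : iIndepFun (fun i ω t => A i t ω) P) {x : ℝ} (hx : 0 ≤ x) (t : ℝ) (n : ℕ) (a : ℝ) :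
    P {ω | a ≤ |∑ i ∈ Finset.range n, (A i t ω - m * t)|} ≤
      2 * ENNReal.ofReal (Real.exp (n * (x ^ 2 * v |t| / 2) - x * a)) := by
  have key : ∀ y : ℝ, P {ω | x * a ≤ ∑ i ∈ Finset.range n, y * (A i t ω - m * t)} ≤
      ENNReal.ofReal (Real.exp (n * (y ^ 2 * v |t| / 2) - x * a)) := by
    intro y
    refine (measure_le_sum_le (Finset.range n) (Y := fun i ω => y * (A i t ω - m * t))
      (hind.comp (fun _ w => y * (w t - m * t)) fun _ => by fun_prop)
      (fun i => ((hA i).measurable t).sub_const _ |>.const_mul y)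
      (κ := fun _ => y ^ 2 * v |t| / 2) (fun i _ => le_of_eq ?_) (x * a)).trans_eq (by simp)
    have h := (hA i).lintegral_exp t t y 0
    rw [cov_self v (hA i).variance_zero] at h
    calc ∫⁻ ω, ENNReal.ofReal (Real.exp (y * (A i t ω - m * t))) ∂P
        = ∫⁻ ω, ENNReal.ofReal (Real.exp (-(y * (m * t)))) *
            ENNReal.ofReal (Real.exp (y * A i t ω + 0 * A i t ω)) ∂P := by
          refine lintegral_congr fun ω => ?_
          rw [← ENNReal.ofReal_mul (Real.exp_pos _).le, ← Real.exp_add]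
          congr 2
          ring
      _ = _ := by
          rw [lintegral_const_mul' _ _ ENNReal.ofReal_ne_top, h,
            ← ENNReal.ofReal_mul (Real.exp_pos _).le, ← Real.exp_add]
          congr 2
          ring
  calc P {ω | a ≤ |∑ i ∈ Finset.range n, (A i t ω - m * t)|}
      ≤ P ({ω | x * a ≤ ∑ i ∈ Finset.range n, x * (A i t ω - m * t)} ∪
          {ω | x * a ≤ ∑ i ∈ Finset.range n, -x * (A i t ω - m * t)}) := by
        refine measure_mono fun ω (hω : a ≤ _) => ?_
        simp only [Set.mem_union, Set.mem_ofPred_eq, ← Finset.mul_sum]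
        rcases le_abs.1 hω with h | h
        · exact Or.inl (mul_le_mul_of_nonneg_left h hx)
        · exact Or.inr (by rw [neg_mul, ← mul_neg]; exact mul_le_mul_of_nonneg_left h hx)
    _ ≤ _ := by
        refine (measure_union_le _ _).trans ?_
        rw [two_mul]
        refine add_le_add (key x) ?_
        simpa using key (-x)

/-- For `x = (κ / 2) t ^ (1 - α)` and `v t ≤ t ^ α` the right side is at least `(κ ^ 2 / 8) t ^ (2 -
α)`, which beats the logarithm. The term `2 log t` later supplies the summable factor `1 / k ^ 2`.
-/
lemma IsGaussianSource.eventually_exponent (hA : IsGaussianSource P (A 0) m v) (K : ℝ) {κ : ℝ}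
    (hκ : 0 < κ) :
    ∀ᶠ t : ℝ in atTop, ∃ x : ℝ, 0 ≤ x ∧
      K + 2 * Real.log t ≤ x * (κ * t / 2) - x ^ 2 * v t / 2 := by
  obtain ⟨α, hα, hlim⟩ := hA.growth
  have hγ : 0 < 2 - α := by linarith
  have hlog := (isLittleO_log_rpow_atTop hγ).bound (c := κ ^ 2 / 32) (by positivity)
  have hK := (tendsto_rpow_atTop hγ).eventually_ge_atTop (16 * K / κ ^ 2)
  filter_upwards [hlim.eventually (gt_mem_nhds one_pos), hlog, hK, eventually_gt_atTop 0]
    with t h1 h2 h3 ht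
  rw [div_lt_one (Real.rpow_pos_of_pos ht α)] at h1
  have hpos := Real.rpow_pos_of_pos ht (2 - α)
  rw [Real.norm_eq_abs, Real.norm_eq_abs, abs_of_pos hpos] at h2
  have h2' := (le_abs_self _).trans h2
  rw [div_le_iff₀ (by positivity)] at h3
  refine ⟨κ / 2 * t ^ (1 - α), by positivity, ?_⟩
  have e1 : t ^ (1 - α) * t = t ^ (2 - α) := by
    rw [← Real.rpow_add_one ht.ne']; ring_nf
  have e2 : (t ^ (1 - α)) ^ 2 * t ^ α = t ^ (2 - α) := by
    rw [← Real.rpow_natCast, ← Real.rpow_mul ht.le, ← Real.rpow_add ht]; push_cast; ring_nf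
  have h4 : (t ^ (1 - α)) ^ 2 * v t ≤ t ^ (2 - α) := by
    rw [← e2]
    exact mul_le_mul_of_nonneg_left h1.le (by positivity)
  have h5 := mul_le_mul_of_nonneg_left h4 (by positivity : 0 ≤ κ ^ 2 / 8)
  have e3 : κ / 2 * t ^ (1 - α) * (κ * t / 2) - (κ / 2 * t ^ (1 - α)) ^ 2 * v t / 2 =
      κ ^ 2 / 4 * (t ^ (1 - α) * t) - κ ^ 2 / 8 * ((t ^ (1 - α)) ^ 2 * v t) := by ring
  rw [e3, e1]
  nlinarith

/-- Excursions of the sum of `n` sources above a line of positive slope are superexponentially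
unlikely far away from the origin. -/
lemma exists_measure_tail_le (hA : ∀ i, IsGaussianSource P (A i) m v)
    (hind : iIndepFun (fun i ω t => A i t ω) P) (K : ℝ) {κ : ℝ} (hκ : 0 < κ) :
    ∃ T : ℝ, ∃ C : ℝ≥0∞, C ≠ ⊤ ∧ ∀ n : ℕ, 1 ≤ n →
      P {ω | ∃ t, T ≤ t ∧ n * (κ * t) < |∑ i ∈ Finset.range n, (A i (-t) ω - m * (-t))|} ≤
        C * ENNReal.ofReal (Real.exp (-(n * K))) := by
  -- Lags up to `1` need only some finite exponential moment, since the threshold grows linearly in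
  -- time.
  obtain ⟨κ₀, hκ₀⟩ : ∃ κ₀ : ℝ, ∀ i t, ∫⁻ ω, oscExp 1 1 (fun q => increment (A i) m t q ω) ∂P ≤
      ENNReal.ofReal (Real.exp κ₀) := by
    have hlt := (hA 0).lintegral_oscExp_lt_top 1 1 0
    refine ⟨(∫⁻ ω, oscExp 1 1 (fun q => increment (A 0) m 0 q ω) ∂P).toReal, fun i t => ?_⟩
    rw [(hA i).lintegral_oscExp_eq (hA 0) 1 1 t 0]
    refine (ENNReal.ofReal_toReal hlt.ne).ge.trans (ENNReal.ofReal_le_ofReal ?_)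
    linarith [Real.add_one_le_exp
      (∫⁻ ω, oscExp 1 1 (fun q => increment (A 0) m 0 q ω) ∂P).toReal]
  have hlin : ∀ᶠ t : ℝ in atTop, K + 2 * Real.log t ≤ κ * t / 2 - κ₀ := by
    filter_upwards [Real.isLittleO_log_id_atTop.bound (c := κ / 8) (by positivity),
      eventually_ge_atTop (4 * (K + κ₀) / κ), eventually_gt_atTop 0] with t h1 h2 h3
    rw [Real.norm_eq_abs, Real.norm_eq_abs, id, abs_of_pos h3] at h1
    have h1' := (le_abs_self _).trans h1
    rw [div_le_iff₀ hκ] at h2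
    linarith
  obtain ⟨k₀, hk₀⟩ := eventually_atTop.1
    (tendsto_natCast_atTop_atTop.eventually
      (((hA 0).eventually_exponent K hκ).and (hlin.and (eventually_ge_atTop (1 : ℝ)))))
  have hsum : Summable fun k : ℕ => 1 / (k : ℝ) ^ 2 :=
    Real.summable_one_div_nat_pow.2 one_lt_two
  refine ⟨k₀, 3 * ∑' k : ℕ, ENNReal.ofReal (1 / (k : ℝ) ^ 2),
    ENNReal.mul_ne_top (by norm_num) hsum.tsum_ofReal_ne_top, fun n hn => ?_⟩
  -- With `k = ⌊t⌋₊`, an excursion at `-t` spends half of its height either at `-k` or on the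
  -- increment over a lag below `1`.
  set S : ℕ → Set Ω := fun k => {ω | k₀ ≤ k ∧
    (n * (κ * k / 2) ≤ |∑ i ∈ Finset.range n, (A i (-(k : ℝ)) ω - m * (-(k : ℝ)))| ∨
      ∃ u, |u| < 1 ∧ n * (κ * k / 2) <
        |∑ i ∈ Finset.range n, (A i (-(k : ℝ) + u) ω - A i (-(k : ℝ)) ω - m * u)|)} with hS
  have hsub : {ω | ∃ t, (k₀ : ℝ) ≤ t ∧
      n * (κ * t) < |∑ i ∈ Finset.range n, (A i (-t) ω - m * (-t))|} ⊆ ⋃ k, S k := by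
    rintro ω ⟨t, htk, ht⟩
    have ht0 : 0 ≤ t := (Nat.cast_nonneg _).trans htk
    refine Set.mem_iUnion.2 ⟨⌊t⌋₊, Nat.le_floor htk, ?_⟩
    by_contra! hcon
    obtain ⟨h1, h2⟩ := hcon
    have hfl := Nat.floor_le ht0
    have h3 := h2 (-(t - ⌊t⌋₊)) (by
      rw [abs_neg, abs_of_nonneg (sub_nonneg.2 hfl)]
      linarith [Nat.lt_floor_add_one t])
    have e : ∑ i ∈ Finset.range n, (A i (-t) ω - m * (-t)) =
        ∑ i ∈ Finset.range n, (A i (-(⌊t⌋₊ : ℝ)) ω - m * (-(⌊t⌋₊ : ℝ))) +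
        ∑ i ∈ Finset.range n, (A i (-(⌊t⌋₊ : ℝ) + -(t - ⌊t⌋₊)) ω - A i (-(⌊t⌋₊ : ℝ)) ω -
          m * (-(t - ⌊t⌋₊))) := by
      rw [← Finset.sum_add_distrib]
      refine Finset.sum_congr rfl fun i _ => ?_
      have : -(⌊t⌋₊ : ℝ) + -(t - ⌊t⌋₊) = -t := by ring
      rw [this]
      ring
    rw [e] at ht
    have h4 := abs_add_le (∑ i ∈ Finset.range n, (A i (-(⌊t⌋₊ : ℝ)) ω - m * (-(⌊t⌋₊ : ℝ))))
      (∑ i ∈ Finset.range n, (A i (-(⌊t⌋₊ : ℝ) + -(t - ⌊t⌋₊)) ω - A i (-(⌊t⌋₊ : ℝ)) ω -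
          m * (-(t - ⌊t⌋₊))))
    have h5 : (n : ℝ) * (κ * ⌊t⌋₊) ≤ n * (κ * t) := by gcongr
    linarith
  have hterm : ∀ k, P (S k) ≤
      3 * ENNReal.ofReal (1 / (k : ℝ) ^ 2) * ENNReal.ofReal (Real.exp (-(n * K))) := by
    intro k
    by_cases hk : k₀ ≤ k
    swap
    · simp [hS, hk]
    obtain ⟨⟨x, hx, h1⟩, h2, h3⟩ := hk₀ k hk
    have hn1 : (1 : ℝ) ≤ n := by exact_mod_cast hn
    have hk0 : (0 : ℝ) < k := by linarith
    -- Here `1 ≤ n` turns `exp (-2 n log k)` into at most `1 / k ^ 2`.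
    have hexp : ∀ y : ℝ, K + 2 * Real.log k ≤ y →
        ENNReal.ofReal (Real.exp (-(n * y))) ≤
          ENNReal.ofReal (1 / (k : ℝ) ^ 2) * ENNReal.ofReal (Real.exp (-(n * K))) := by
      intro y hy
      rw [← ENNReal.ofReal_mul (by positivity)]
      refine ENNReal.ofReal_le_ofReal ?_
      have e : 1 / (k : ℝ) ^ 2 = Real.exp (-(2 * Real.log k)) := by
        rw [Real.exp_neg, mul_comm, Real.exp_mul, Real.exp_log hk0, one_div]
        norm_cast
      rw [e, ← Real.exp_add]
      refine Real.exp_le_exp.2 ?_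
      have hl := Real.log_nonneg h3
      nlinarith
    calc P (S k) ≤ P ({ω | n * (κ * k / 2) ≤
            |∑ i ∈ Finset.range n, (A i (-(k : ℝ)) ω - m * (-(k : ℝ)))|} ∪
          {ω | ∃ u, |u| < 1 ∧ n * (κ * k / 2) <
            |∑ i ∈ Finset.range n, (A i (-(k : ℝ) + u) ω - A i (-(k : ℝ)) ω - m * u)|}) :=
          measure_mono fun ω hω => hω.2
      _ ≤ 2 * ENNReal.ofReal (Real.exp (-(n * (x * (κ * k / 2) - x ^ 2 * v k / 2)))) +
          ENNReal.ofReal (Real.exp (-(n * (κ * k / 2 - κ₀)))) := by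
          refine (measure_union_le _ _).trans (add_le_add ?_ ?_)
          · refine (measure_le_abs_sum_le hA hind hx _ n _).trans_eq ?_
            rw [abs_neg, abs_of_pos hk0]
            congr 3
            ring
          · refine (measure_osc_le hA hind (θ := 1) zero_le_one (fun i => hκ₀ i _) n _).trans_eq ?_
            congr 2
            ring
      _ ≤ _ := by
          refine (add_le_add (mul_le_mul_right (hexp _ h1) 2) (hexp _ h2)).trans_eq ?_
          ring
  calc _ ≤ P (⋃ k, S k) := measure_mono hsub
    _ ≤ ∑' k, P (S k) := measure_iUnion_le _
    _ ≤ ∑' k : ℕ, 3 * ENNReal.ofReal (1 / (k : ℝ) ^ 2) * ENNReal.ofReal (Real.exp (-(n * K))) :=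
        ENNReal.tsum_le_tsum hterm
    _ = _ := by rw [ENNReal.tsum_mul_right, ENNReal.tsum_mul_left]

end Tail

/-! ### Quadratic duality and paths of small rate -/

section Duality

/-- Evaluating at `(q, -p)` gives `p (p r - q ^ 2) ≥ 0`; if `p = 0` and `q ≠ 0`, a suitable vector
makes the form equal to `-1`. -/
lemma sq_le_mul_of_quadratic_nonneg {p q r : ℝ}
    (h : ∀ x y : ℝ, 0 ≤ p * x ^ 2 + 2 * q * x * y + r * y ^ 2) : q ^ 2 ≤ p * r := by
  have hp := h 1 0
  have h1 := h q (-p)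
  rcases (show 0 ≤ p by linarith).lt_or_eq with h0 | h0
  · have : 0 ≤ p * (p * r - q ^ 2) := by linarith
    linarith [nonneg_of_mul_nonneg_right this h0]
  · subst h0
    by_contra! hq
    have hq0 : q ≠ 0 := by rintro rfl; simp at hq
    have h2 := h (-(r + 1) / (2 * q)) 1
    have e : 2 * q * (-(r + 1) / (2 * q)) = -(r + 1) := by field_simp
    rw [e] at h2
    linarith

/-- Duality for the minimization of a positive semidefinite quadratic form in two variables under
two linear constraints given by the same form: a bound for the dual problem is attained by a
feasible point. -/
lemma exists_feasible_of_dual_le {p q r a₁ a₂ K : ℝ}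
    (hnn : ∀ x y : ℝ, 0 ≤ p * x ^ 2 + 2 * q * x * y + r * y ^ 2) (ha : 0 < a₁)
    (hK : ∀ x y : ℝ, 0 ≤ x → 0 ≤ y →
      x * a₁ + y * a₂ - (p * x ^ 2 + 2 * q * x * y + r * y ^ 2) / 2 ≤ K) :
    ∃ x y : ℝ, a₁ ≤ p * x + q * y ∧ a₂ ≤ q * x + r * y ∧
      (p * x ^ 2 + 2 * q * x * y + r * y ^ 2) / 2 ≤ K := by
  have hdet := sq_le_mul_of_quadratic_nonneg hnn
  -- If `p = 0`, the dual objective is unbounded along the first axis because `a₁ > 0`.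
  have hp : 0 < p := by
    have h1 := hnn 1 0
    refine (show 0 ≤ p by linarith).lt_of_ne' fun h0 => ?_
    have h2 := hK ((|K| + 1) / a₁) 0 (by positivity) le_rfl
    rw [h0, div_mul_cancel₀ _ ha.ne'] at h2
    have := le_abs_self K
    simp at h2
    linarith
  have hr : 0 ≤ r := by linarith [hnn 0 1]
  rcases le_or_gt a₂ (q * (a₁ / p)) with h2 | h2
  -- Only the first constraint is active.
  · refine ⟨a₁ / p, 0, by field_simp; simp, by simpa using h2, ?_⟩
    have h := hK (a₁ / p) 0 (by positivity) le_rfl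
    have e : p * (a₁ / p) ^ 2 = a₁ / p * a₁ := by field_simp
    rw [e] at h ⊢
    linarith
  rw [← mul_div_assoc, div_lt_iff₀ hp] at h2
  by_cases h3 : 0 < r ∧ 0 < a₂ ∧ r * a₁ ≤ q * a₂
  -- Only the second constraint is active.
  · obtain ⟨hr0, ha2, h3⟩ := h3
    refine ⟨0, a₂ / r, ?_, by field_simp; simp, ?_⟩
    · rw [mul_zero, zero_add, ← mul_div_assoc, le_div_iff₀ hr0]
      linarith
    · have h := hK 0 (a₂ / r) le_rfl (by positivity)
      have e : r * (a₂ / r) ^ 2 = a₂ / r * a₂ := by field_simp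
      rw [e] at h ⊢
      linarith
  -- the first dual variable of the unconstrained optimum is nonnegative
  have h4 : q * a₂ ≤ r * a₁ := by
    by_contra! h4
    rcases lt_trichotomy q 0 with hq | hq | hq
    · have : a₂ < 0 := by nlinarith
      nlinarith
    · subst hq; nlinarith
    · have hr0 : 0 < r := by nlinarith
      have : 0 < a₂ := by nlinarith
      exact h3 ⟨hr0, this, h4.le⟩
  rcases hdet.lt_or_eq with hd | hd
  -- Both constraints are active: Cramer's rule gives multipliers, nonnegative by `h4` and `h2`, at
  -- which primal and dual values agree.
  · have hD : 0 < p * r - q ^ 2 := by linarith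
    set D := p * r - q ^ 2 with hDdef
    have hx : 0 ≤ (r * a₁ - q * a₂) / D := div_nonneg (by linarith) hD.le
    have hy : 0 ≤ (p * a₂ - q * a₁) / D := div_nonneg (by linarith) hD.le
    have e1 : p * ((r * a₁ - q * a₂) / D) + q * ((p * a₂ - q * a₁) / D) = a₁ := by
      rw [← mul_div_assoc, ← mul_div_assoc, ← add_div, div_eq_iff hD.ne', hDdef]; ring
    have e2 : q * ((r * a₁ - q * a₂) / D) + r * ((p * a₂ - q * a₁) / D) = a₂ := by
      rw [← mul_div_assoc, ← mul_div_assoc, ← add_div, div_eq_iff hD.ne', hDdef]; ring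
    have h := hK _ _ hx hy
    refine ⟨_, _, e1.ge, e2.ge, ?_⟩
    generalize (r * a₁ - q * a₂) / D = x at *
    generalize (p * a₂ - q * a₁) / D = y at *
    rw [← e1, ← e2] at h
    linarith
  · exfalso
    rcases le_or_gt q 0 with hq | hq
    · -- along `(-q, p)` the form vanishes and the linear part is positive
      have hpos : 0 < -q * a₁ + p * a₂ := by linarith
      set τ := (|K| + 1) / (-q * a₁ + p * a₂) with hτ
      have hτ0 : 0 < τ := by positivity
      have h := hK (τ * -q) (τ * p) (mul_nonneg hτ0.le (by linarith)) (by positivity)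
      have e1 : τ * -q * a₁ + τ * p * a₂ = |K| + 1 := by
        rw [hτ, mul_assoc, mul_assoc, ← mul_add, div_mul_cancel₀ _ hpos.ne']
      have e2 : p * (τ * -q) ^ 2 + 2 * q * (τ * -q) * (τ * p) + r * (τ * p) ^ 2 =
          τ ^ 2 * p * (p * r - q ^ 2) := by ring
      rw [e1, e2, hd] at h
      have := le_abs_self K
      simp at h
      linarith
    · have hr0 : 0 < r := by nlinarith
      have : 0 < a₂ := by nlinarith
      refine h3 ⟨hr0, this, ?_⟩
      nlinarith

variable {Ω : Type*} [MeasurableSpace Ω] {P : Measure Ω} {A : ℝ → Ω → ℝ} {m : ℝ} {v : ℝ → ℝ}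

lemma IsGaussianSource.cov_quadratic_nonneg (hA : IsGaussianSource P A m v) (s t x y : ℝ) :
    0 ≤ cov v s s * x ^ 2 + 2 * cov v s t * x * y + cov v t t * y ^ 2 := by
  have := hA.isGaussian.isProbabilityMeasure
  have h := ProbabilityTheory.variance_nonneg (fun ω => x * A s ω + y * A t ω) P
  rw [variance_fun_add ((hA.memLp_two s).const_mul x) ((hA.memLp_two t).const_mul y),
      variance_const_mul, variance_const_mul, covariance_const_mul_left,
      covariance_const_mul_right, hA.covariance_eq, ← covariance_self (hA.memLp_two s).aemeasurable,
      ← covariance_self (hA.memLp_two t).aemeasurable, hA.covariance_eq, hA.covariance_eq] at h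
  linarith

lemma IsGaussianSource.abs_cov_le (hA : IsGaussianSource P A m v) (s t : ℝ) :
    |cov v s t| ≤ √(v |s|) * √(v |t|) := by
  have h := sq_le_mul_of_quadratic_nonneg (hA.cov_quadratic_nonneg s t)
  rw [cov_self v hA.variance_zero, cov_self v hA.variance_zero] at h
  rw [← Real.sqrt_mul (hA.variance_nonneg s)]
  exact Real.abs_le_sqrt h

/-- The square root of the variance is an `L²` seminorm, so Cauchy–Schwarz gives a reverse triangle
inequality that reduces continuity to time `0`. -/
lemma IsGaussianSource.continuous_variance (hA : IsGaussianSource P A m v) :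
    Continuous fun t => v |t| := by
  have hs : Continuous fun t => √(v |t|) := by
    refine continuous_iff_continuousAt.2 fun s => ?_
    have hle : ∀ t, |√(v |t|) - √(v |s|)| ≤ √(v |t - s|) := by
      intro t
      refine Real.abs_le_sqrt ?_
      have h := (abs_le.1 (hA.abs_cov_le s t)).2
      rw [cov] at h
      nlinarith [Real.sq_sqrt (hA.variance_nonneg s), Real.sq_sqrt (hA.variance_nonneg t)]
    have h0 : Tendsto (fun t => √(v |t - s|)) (𝓝 s) (𝓝 0) := by
      have h1 : Tendsto (fun t => t - s) (𝓝 s) (𝓝 0) := by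
        simpa using (continuous_id.sub continuous_const).tendsto (f := fun t : ℝ => t - s) s
      simpa using (hA.tendsto_variance_zero.comp h1).sqrt
    exact tendsto_iff_dist_tendsto_zero.2
      (squeeze_zero (fun _ => dist_nonneg) (fun t => by rw [Real.dist_eq]; exact hle t) h0)
  exact (hs.pow 2).congr fun t => Real.sq_sqrt (hA.variance_nonneg t)

lemma IsGaussianSource.tendsto_sqrt_variance_div (hA : IsGaussianSource P A m v) :
    Tendsto (fun t => √(v t) / (1 + t)) atTop (𝓝 0) := by
  obtain ⟨α, hα, hlim⟩ := hA.growth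
  have h1 : Tendsto (fun t : ℝ => √(v t / t ^ α * t ^ (-(2 - α)))) atTop (𝓝 0) := by
    simpa using (hlim.mul (tendsto_rpow_neg_atTop (by linarith : 0 < 2 - α))).sqrt
  refine squeeze_zero' ?_ ?_ h1
  · filter_upwards [eventually_ge_atTop 0] with t ht using by positivity
  · filter_upwards [eventually_gt_atTop 0] with t ht
    have e : v t / t ^ α * t ^ (-(2 - α)) = v t / t ^ 2 := by
      rw [div_mul_eq_mul_div, div_eq_div_iff (by positivity) (by positivity), mul_assoc]
      congr 1
      rw [← Real.rpow_natCast, ← Real.rpow_add ht]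
      congr 1
      push_cast
      ring
    rw [e, Real.sqrt_div' _ (by positivity), Real.sqrt_sq ht.le]
    gcongr
    linarith

/-- Cauchy–Schwarz reduces the sublinear growth to that of the standard deviation, where `α < 2`
enters. Covariance functions are thus admissible as building blocks of competitor paths. -/
lemma IsGaussianSource.cov_mem_pathSpace (hA : IsGaussianSource P A m v) (s : ℝ) :
    cov v s ∈ pathSpace := by
  have hbound : ∀ t, ‖cov v s t / (1 + |t|)‖ ≤ √(v |s|) * (√(v |t|) / (1 + |t|)) := by
    intro t
    have : 0 < 1 + |t| := by positivity
    rw [norm_div, Real.norm_eq_abs, Real.norm_eq_abs, abs_of_pos this, ← mul_div_assoc]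
    exact div_le_div_of_nonneg_right (hA.abs_cov_le s t) this.le
  have hlim := hA.tendsto_sqrt_variance_div.const_mul (√(v |s|))
  rw [mul_zero] at hlim
  refine ⟨?_, ?_, ?_, ?_⟩
  · have h1 := hA.continuous_variance
    have h2 : Continuous fun t => v |t - s| := h1.comp (continuous_id.sub continuous_const)
    exact ((h1.sub h2).add continuous_const).div_const 2
  · simp [cov, hA.variance_zero]
  · exact squeeze_zero_norm hbound (hlim.comp tendsto_abs_atTop_atTop)
  · exact squeeze_zero_norm hbound (hlim.comp tendsto_abs_atBot_atTop)

lemma pathSpace_linearCombination {f g : ℝ → ℝ} (hf : f ∈ pathSpace) (hg : g ∈ pathSpace)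
    (x y : ℝ) : (fun t => x * f t + y * g t) ∈ pathSpace := by
  obtain ⟨f1, f2, f3, f4⟩ := hf
  obtain ⟨g1, g2, g3, g4⟩ := hg
  have key : ∀ {l : Filter ℝ}, Tendsto (fun t => f t / (1 + |t|)) l (𝓝 0) →
      Tendsto (fun t => g t / (1 + |t|)) l (𝓝 0) →
      Tendsto (fun t => (x * f t + y * g t) / (1 + |t|)) l (𝓝 0) := by
    intro l hf hg
    have := (hf.const_mul x).add (hg.const_mul y)
    simp only [mul_zero, add_zero] at this
    exact this.congr fun t => by ring
  exact ⟨by fun_prop, by simp [f2, g2], key f3 g3, key f4 g4⟩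

/-- By the reproducing property the squared norm is the Gram quadratic form. Only an upper bound is
needed, to exhibit a cheap competitor. -/
lemma IsGaussianSource.rate_cov_le (hA : IsGaussianSource P A m v) (s t x y : ℝ) :
    rate v (fun u => x * cov v s u + y * cov v t u) ≤
      ENNReal.ofReal ((cov v s s * x ^ 2 + 2 * cov v s t * x * y + cov v t t * y ^ 2) / 2) := by
  have hpsd := hA.posSemidef
  rw [rate, dif_pos hpsd]
  have : Fact (covKernel v).PosSemidef := ⟨hpsd⟩
  have hker : ∀ a u : ℝ, RKHS.kerFun (RKHS.OfKernel (covKernel v)) a (1 : ℝ) u = cov v a u := by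
    intro a u
    rw [RKHS.kerFun_apply, RKHS.OfKernel.kernel_ofKernel, cov_comm]
    simp [covKernel]
  set g : RKHS.OfKernel (covKernel v) :=
    x • RKHS.kerFun (RKHS.OfKernel (covKernel v)) s (1 : ℝ) +
      y • RKHS.kerFun (RKHS.OfKernel (covKernel v)) t (1 : ℝ) with hg
  refine iInf₂_le_of_le g ?_ (ENNReal.ofReal_le_ofReal (le_of_eq ?_))
  · ext u
    rw [hg, RKHS.coe_add, RKHS.coe_smul, RKHS.coe_smul]
    simp [hker]
  · congr 1
    rw [← real_inner_self_eq_norm_sq, hg, inner_add_left, inner_smul_left, inner_smul_left,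
      RKHS.kerFun_inner, RKHS.kerFun_inner, RKHS.coe_add, RKHS.coe_smul, RKHS.coe_smul]
    simp [hker, cov_comm v t s]
    ring

variable {B : ℝ → Ω → ℝ} {mh ml : ℝ} {vh vl : ℝ → ℝ}

/-- Every lower bound of the rate function on `U_p^{s,t}` is below the exponent of some Chernoff
bound with nonnegative multipliers. -/
lemma exists_multipliers (hh : IsGaussianSource P A mh vh) (hl : IsGaussianSource P B ml vl)
    {b c s t K : ℝ} (ha : 0 < b + (c - mh - ml) * t)
    (hK : ENNReal.ofReal K < ⨅ f ∈ overflowSet mh ml b c s t, pairRate vh vl mh ml f) :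
    ∃ x y : ℝ, 0 ≤ x ∧ 0 ≤ y ∧
      K < x * (b + (c - mh - ml) * t) + y * (b + (c - mh - ml) * t - (c - mh) * s) -
        (cov vh (-s) (-s) * y ^ 2 + 2 * cov vh (-s) (-t) * y * (-(x + y)) +
          cov vh (-t) (-t) * (-(x + y)) ^ 2 + cov vl (-t) (-t) * (x + y) ^ 2) / 2 := by
  by_contra! hcon
  set gss := cov vh (-s) (-s) with hgss
  set gst := cov vh (-s) (-t) with hgst
  set gtt := cov vh (-t) (-t) with hgtt
  set l := cov vl (-t) (-t) with hldef
  have hl0 : 0 ≤ l := by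
    rw [hldef, cov_self vl hl.variance_zero]
    exact hl.variance_nonneg _
  -- The entries `p`, `q`, `r` are the covariances of `-A_h(-t) - A_ℓ(-t)` and `A_h(-s) - A_h(-t) -
  -- A_ℓ(-t)`; `a₁` and `a₂` are the thresholds after centering.
  obtain ⟨x, y, h1, h2, h3⟩ := exists_feasible_of_dual_le
    (p := gtt + l) (q := gtt - gst + l) (r := gss - 2 * gst + gtt + l) (K := K)
    (a₂ := b + (c - mh - ml) * t - (c - mh) * s) (fun x y => by
      have h1 := hh.cov_quadratic_nonneg (-s) (-t) y (-(x + y))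
      have h2 : 0 ≤ l * (x + y) ^ 2 := by positivity
      linarith) ha (fun x y hx hy => by
        refine le_trans (le_of_eq ?_) (hcon x y hx hy)
        ring)
  refine absurd hK (not_lt.2 ?_)
  -- The competitor combines the representers of the two constraint functionals, with weights `x`
  -- and `y`.
  set wh : ℝ → ℝ := fun u => y * cov vh (-s) u + (-(x + y)) * cov vh (-t) u with hwh
  set wl : ℝ → ℝ := fun u => (-(x + y)) * cov vl (-t) u + 0 * cov vl (-t) u with hwl
  have ch : centered mh (fun u => wh u + mh * u) = wh := by
    ext u; simp [centered]
  have cl : centered ml (fun u => wl u + ml * u) = wl := by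
    ext u; simp [centered]
  refine iInf₂_le_of_le (fun u => wh u + mh * u, fun u => wl u + ml * u) ?_ ?_
  · refine ⟨?_, ?_, ?_, ?_⟩
    · rw [ch]
      exact pathSpace_linearCombination (hh.cov_mem_pathSpace _) (hh.cov_mem_pathSpace _) _ _
    · rw [cl]
      exact pathSpace_linearCombination (hl.cov_mem_pathSpace _) (hl.cov_mem_pathSpace _) _ _
    · simp only [hwh, hwl, ← hgst, ← hgtt, ← hldef]
      linarith
    · simp only [hwh, hwl, cov_comm vh (-t) (-s), ← hgss, ← hgst, ← hgtt, ← hldef]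
      linarith
  · rw [pairRate, ch, cl]
    refine (add_le_add (hh.rate_cov_le _ _ _ _) (hl.rate_cov_le _ _ _ _)).trans ?_
    rw [← ENNReal.ofReal_add (div_nonneg (hh.cov_quadratic_nonneg _ _ _ _) two_pos.le)
      (div_nonneg (hl.cov_quadratic_nonneg _ _ _ _) two_pos.le)]
    refine ENNReal.ofReal_le_ofReal (le_trans (le_of_eq ?_) h3)
    simp only [← hgss, ← hgst, ← hgtt, ← hldef]
    ring

end Duality

/-! ### From overflow to two-time events -/

section Overflow

variable {Ω : Type*} {Ah Al : ℕ → ℝ → Ω → ℝ} {mh ml b c : ℝ} {vh vl : ℝ → ℝ}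

/-- The low-priority content at time `0` exceeds `n b`, with the traffic that arrived in `(-t, 0]`
responsible for it. -/
def LowOverflowAt (Ah Al : ℕ → ℝ → Ω → ℝ) (b c : ℝ) (n : ℕ) (t : ℝ) (ω : Ω) : Prop :=
  n * (b + c * t) < ∑ i ∈ Finset.range n, (-Ah i (-t) ω - Al i (-t) ω) ∧
    ∀ s, 0 < s → n * (b + c * (t - s)) <
      ∑ i ∈ Finset.range n, (Ah i (-s) ω - Ah i (-t) ω - Al i (-t) ω)

/-- Overflow caused by an overload in one of the two classes. -/
lemma LowOverflowAt.lt_abs_or_lt_abs {n : ℕ} {t : ℝ} {ω : Ω} (h : LowOverflowAt Ah Al b c n t ω)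
    (mh ml : ℝ) :
    n * ((b + (c - mh - ml) * t) / 2) < |∑ i ∈ Finset.range n, (Ah i (-t) ω - mh * (-t))| ∨
      n * ((b + (c - mh - ml) * t) / 2) < |∑ i ∈ Finset.range n, (Al i (-t) ω - ml * (-t))| := by
  by_contra! hcon
  obtain ⟨h1, h2⟩ := hcon
  have h3 := h.1
  have e : ∑ i ∈ Finset.range n, (-Ah i (-t) ω - Al i (-t) ω) =
      -∑ i ∈ Finset.range n, (Ah i (-t) ω - mh * (-t)) -
        ∑ i ∈ Finset.range n, (Al i (-t) ω - ml * (-t)) + n * ((mh + ml) * t) := by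
    simp only [Finset.sum_sub_distrib, Finset.sum_const, Finset.card_range, nsmul_eq_mul,
      Finset.sum_neg_distrib]
    ring
  rw [e] at h3
  linarith [(abs_le.1 h1).1, (abs_le.1 h2).1]

variable [MeasurableSpace Ω] {P : Measure Ω}

/-- An infinite high-priority content makes the difference `⊥`, so on overflow it is a real `q`.
Some `t` has total input minus service above `n b + q`; the two conditions follow from `q ≥ 0` and
from `q` dominating each term of its supremum. -/
lemma ae_exists_lowOverflowAt (hh : ∀ i, IsGaussianSource P (Ah i) mh vh)
    (hl : ∀ i, IsGaussianSource P (Al i) ml vl) (n : ℕ) :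
    ∀ᵐ ω ∂P, ((n * b : ℝ) : EReal) < lowQueue Ah Al c n ω →
      ∃ t, 0 < t ∧ LowOverflowAt Ah Al b c n t ω := by
  filter_upwards [ae_all_iff.2 fun i => (hh i).continuous, ae_all_iff.2 fun i => (hh i).zero,
    ae_all_iff.2 fun i => (hl i).zero] with ω hc h0 l0 hlt
  rw [lowQueue] at hlt
  have hle : ∀ s, 0 < s → ((∑ i ∈ Finset.range n, (Ah i 0 ω - Ah i (-s) ω) - n * c * s : ℝ) :
      EReal) ≤ queue Ah c n ω := fun s hs => le_iSup₂_of_le s hs le_rfl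
  have htop : queue Ah c n ω ≠ ⊤ := by
    intro h
    rw [h, EReal.sub_top] at hlt
    exact not_lt_bot hlt
  have hbot : queue Ah c n ω ≠ ⊥ := ((EReal.bot_lt_coe _).trans_le (hle 1 one_pos)).ne'
  obtain ⟨q, hq⟩ : ∃ q : ℝ, (q : EReal) = queue Ah c n ω := ⟨_, EReal.coe_toReal htop hbot⟩
  rw [← hq] at hlt hle
  simp only [EReal.coe_le_coe_iff] at hle
  -- The supremum omits `s = 0`, so the value `0` is reached as the limit `s ↓ 0`.
  have hq0 : 0 ≤ q := by
    have hcont : Continuous fun s : ℝ =>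
        ∑ i ∈ Finset.range n, (Ah i 0 ω - Ah i (-s) ω) - n * c * s := by
      refine (continuous_finsetSum _ fun i _ => ?_).sub (by fun_prop)
      exact continuous_const.sub ((hc i).comp continuous_neg)
    have hlim := (hcont.tendsto 0).mono_left (nhdsWithin_le_nhds (s := Set.Ioi 0))
    simp only [neg_zero, sub_self, Finset.sum_const_zero, mul_zero] at hlim
    exact le_of_tendsto hlim (eventually_mem_nhdsWithin.mono hle)
  have hadd := EReal.add_lt_of_lt_sub hlt
  rw [← EReal.coe_add, queue] at hadd
  obtain ⟨t, ht⟩ := lt_iSup_iff.1 hadd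
  obtain ⟨ht0, ht⟩ := lt_iSup_iff.1 ht
  rw [EReal.coe_lt_coe_iff] at ht
  simp only [h0, l0] at ht hle
  have e : ∑ i ∈ Finset.range n, (0 + 0 - (Ah i (-t) ω + Al i (-t) ω)) =
      ∑ i ∈ Finset.range n, (-Ah i (-t) ω - Al i (-t) ω) :=
    Finset.sum_congr rfl fun i _ => by ring
  rw [e] at ht
  refine ⟨t, ht0, by linarith, fun s hs => ?_⟩
  have e2 : ∑ i ∈ Finset.range n, (Ah i (-s) ω - Ah i (-t) ω - Al i (-t) ω) =
      ∑ i ∈ Finset.range n, (-Ah i (-t) ω - Al i (-t) ω) -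
        ∑ i ∈ Finset.range n, (0 - Ah i (-s) ω) := by
    rw [← Finset.sum_sub_distrib]
    exact Finset.sum_congr rfl fun i _ => by ring
  rw [e2]
  linarith [hle s hs]

/-! ### Probability bounds for large, small and intermediate times -/

section Bounds

variable (hh : ∀ i, IsGaussianSource P (Ah i) mh vh) (hl : ∀ i, IsGaussianSource P (Al i) ml vl)
  (hindep : iIndepFun (fun (k : ℕ ⊕ ℕ) (ω : Ω) (t : ℝ) => Sum.elim Ah Al k t ω) P)

include hh hl hindep

lemma exists_measure_overflow_tail_le (hb : 0 < b) (hc : mh + ml < c) (K : ℝ) :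
    ∃ T : ℝ, ∃ C : ℝ≥0∞, C ≠ ⊤ ∧ ∀ n : ℕ, 1 ≤ n →
      P {ω | ∃ t, T ≤ t ∧ LowOverflowAt Ah Al b c n t ω} ≤
        C * ENNReal.ofReal (Real.exp (-(n * K))) := by
  have hih : iIndepFun (fun i ω t => Ah i t ω) P := hindep.precomp Sum.inl_injective
  have hil : iIndepFun (fun i ω t => Al i t ω) P := hindep.precomp Sum.inr_injective
  have hκ : 0 < (c - mh - ml) / 2 := by linarith
  obtain ⟨T₁, C₁, hC₁, h₁⟩ := exists_measure_tail_le hh hih K hκ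
  obtain ⟨T₂, C₂, hC₂, h₂⟩ := exists_measure_tail_le hl hil K hκ
  refine ⟨max T₁ T₂, C₁ + C₂, ENNReal.add_ne_top.2 ⟨hC₁, hC₂⟩, fun n hn => ?_⟩
  rw [add_mul]
  refine le_trans (measure_mono ?_) ((measure_union_le _ _).trans (add_le_add (h₁ n hn) (h₂ n hn)))
  rintro ω ⟨t, ht, hover⟩
  have hle : n * ((c - mh - ml) / 2 * t) ≤ n * ((b + (c - mh - ml) * t) / 2) :=
    mul_le_mul_of_nonneg_left (by linarith) (Nat.cast_nonneg n)
  rcases hover.lt_abs_or_lt_abs mh ml with h | h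
  · exact Or.inl ⟨t, (le_max_left _ _).trans ht, hle.trans_lt h⟩
  · exact Or.inr ⟨t, (le_max_right _ _).trans ht, hle.trans_lt h⟩

/-- However small `t` is, one class must deviate from its mean by more than `n b / 2` over that
short lag. -/
lemma exists_measure_overflow_near_zero_le (hb : 0 < b) (hc : mh + ml < c) (K : ℝ) :
    ∃ δ > 0, ∀ n : ℕ, P {ω | ∃ t, |t| < δ ∧ 0 < t ∧ LowOverflowAt Ah Al b c n t ω} ≤
      2 * ENNReal.ofReal (Real.exp (-(n * K))) := by
  have hih : iIndepFun (fun i ω t => Ah i t ω) P := hindep.precomp Sum.inl_injective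
  have hil : iIndepFun (fun i ω t => Al i t ω) P := hindep.precomp Sum.inr_injective
  obtain ⟨δ₁, hδ₁, h₁⟩ := exists_measure_osc_le hh hih K (half_pos hb)
  obtain ⟨δ₂, hδ₂, h₂⟩ := exists_measure_osc_le hl hil K (half_pos hb)
  refine ⟨min δ₁ δ₂, lt_min hδ₁ hδ₂, fun n => ?_⟩
  rw [two_mul]
  refine le_trans (measure_mono_ae ?_)
    ((measure_union_le _ _).trans (add_le_add (h₁ 0 n) (h₂ 0 n)))
  filter_upwards [ae_all_iff.2 fun i => (hh i).zero, ae_all_iff.2 fun i => (hl i).zero]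
    with ω h0 l0
  rintro ⟨t, ht, ht0, hover⟩
  have hle : n * (b / 2) ≤ n * ((b + (c - mh - ml) * t) / 2) := by
    refine mul_le_mul_of_nonneg_left ?_ (Nat.cast_nonneg n)
    nlinarith
  rw [← abs_neg] at ht
  rcases hover.lt_abs_or_lt_abs mh ml with h | h
  · refine Or.inl ⟨-t, ht.trans_le (min_le_left _ _), ?_⟩
    simpa [h0] using hle.trans_lt h
  · refine Or.inr ⟨-t, ht.trans_le (min_le_right _ _), ?_⟩
    simpa [l0] using hle.trans_lt h

/-- The Chernoff bound at the time pair `(s, t)` with multipliers `x` and `y`. -/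
lemma measure_linear_le (x y s t a : ℝ) (n : ℕ) :
    P {ω | a ≤ ∑ i ∈ Finset.range n, (y * Ah i (-s) ω - (x + y) * Ah i (-t) ω -
        (x + y) * Al i (-t) ω)} ≤
      ENNReal.ofReal (Real.exp (n * ((x + y) * (mh + ml) * t - y * mh * s +
        (cov vh (-s) (-s) * y ^ 2 + 2 * cov vh (-s) (-t) * y * (-(x + y)) +
          cov vh (-t) (-t) * (-(x + y)) ^ 2 + cov vl (-t) (-t) * (x + y) ^ 2) / 2) - a)) := by
  -- The zero terms put the low-priority part into the two-time form of `lintegral_exp`.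
  set Y : ℕ ⊕ ℕ → Ω → ℝ := Sum.elim
    (fun i ω => y * Ah i (-s) ω + -(x + y) * Ah i (-t) ω)
    (fun i ω => -(x + y) * Al i (-t) ω + 0 * Al i (-t) ω) with hY
  set g : ℕ ⊕ ℕ → (ℝ → ℝ) → ℝ := Sum.elim
    (fun _ w => y * w (-s) + -(x + y) * w (-t))
    (fun _ w => -(x + y) * w (-t) + 0 * w (-t)) with hg
  have hYind : iIndepFun Y P := by
    have hgm : ∀ k, Measurable (g k) := by
      rintro (i | i) <;> simp only [hg, Sum.elim_inl, Sum.elim_inr] <;> fun_prop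
    convert hindep.comp g hgm using 1
    ext (i | i) ω <;> rfl
  have hYm : ∀ k, Measurable (Y k) := by
    rintro (i | i)
    · exact (((hh i).measurable _).const_mul _).add (((hh i).measurable _).const_mul _)
    · exact (((hl i).measurable _).const_mul _).add (((hl i).measurable _).const_mul _)
  have h := measure_le_sum_le ((Finset.range n).disjSum (Finset.range n)) hYind hYm
    (κ := Sum.elim
      (fun _ => (y * -s + -(x + y) * -t) * mh + (y ^ 2 * cov vh (-s) (-s) +
        2 * y * -(x + y) * cov vh (-s) (-t) + (-(x + y)) ^ 2 * cov vh (-t) (-t)) / 2)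
      (fun _ => (-(x + y) * -t + 0 * -t) * ml + ((-(x + y)) ^ 2 * cov vl (-t) (-t) +
        2 * -(x + y) * 0 * cov vl (-t) (-t) + 0 ^ 2 * cov vl (-t) (-t)) / 2))
    (by
      rintro (i | i) -
      · exact ((hh i).lintegral_exp _ _ _ _).le
      · exact ((hl i).lintegral_exp _ _ _ _).le) a
  convert h using 3
  · ext ω
    rw [Finset.sum_disjSum, ← Finset.sum_add_distrib]
    have e : ∀ i, Y (Sum.inl i) ω + Y (Sum.inr i) ω =
        y * Ah i (-s) ω - (x + y) * Ah i (-t) ω - (x + y) * Al i (-t) ω := by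
      intro i
      simp only [hY, Sum.elim_inl, Sum.elim_inr]
      ring
    simp_rw [e]
  · rw [Finset.sum_disjSum]
    simp only [Sum.elim_inl, Sum.elim_inr, Finset.sum_const, Finset.card_range, nsmul_eq_mul]
    ring

/-- The pair `(s, t)` and its multipliers stay fixed while `r` varies. The strict slack in the
Chernoff exponent pays for moving from `r` to `t`, unless one class oscillates too much. -/
lemma exists_measure_overflow_near_le (hb : 0 < b) (hc : mh + ml < c) {t : ℝ} (ht : 0 < t)
    {K : ℝ} (hK : ENNReal.ofReal K < ⨆ (s : ℝ) (_ : 0 < s),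
      ⨅ f ∈ overflowSet mh ml b c s t, pairRate vh vl mh ml f) :
    ∃ δ > 0, ∀ n : ℕ, P {ω | ∃ r, |r - t| < δ ∧ 0 < r ∧ LowOverflowAt Ah Al b c n r ω} ≤
      3 * ENNReal.ofReal (Real.exp (-(n * K))) := by
  have hih : iIndepFun (fun i ω t => Ah i t ω) P := hindep.precomp Sum.inl_injective
  have hil : iIndepFun (fun i ω t => Al i t ω) P := hindep.precomp Sum.inr_injective
  obtain ⟨s, hK⟩ := lt_iSup_iff.1 hK
  obtain ⟨hs, hK⟩ := lt_iSup_iff.1 hK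
  have hcpos : 0 < c - mh - ml := by linarith
  obtain ⟨x, y, hx, hy, hxy⟩ := exists_multipliers (hh 0) (hl 0) (by positivity) hK
  set Q := cov vh (-s) (-s) * y ^ 2 + 2 * cov vh (-s) (-t) * y * (-(x + y)) +
    cov vh (-t) (-t) * (-(x + y)) ^ 2 + cov vl (-t) (-t) * (x + y) ^ 2 with hQ
  set G := x * (b + (c - mh - ml) * t) + y * (b + (c - mh - ml) * t - (c - mh) * s) - Q / 2 - K
    with hG
  have hG0 : 0 < G := by linarith
  -- There are three errors, from the two oscillations and the change of drift, each at most `(x +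
  -- y) η` per source; together they stay below the slack `G`.
  set η := G / (4 * (x + y + 1)) with hη
  have hη0 : 0 < η := by positivity
  have hηG : 3 * ((x + y) * η) ≤ G := by
    have : η * (4 * (x + y + 1)) = G := div_mul_cancel₀ _ (by positivity)
    nlinarith [mul_nonneg (add_nonneg hx hy) hη0.le]
  obtain ⟨δ₁, hδ₁, h₁⟩ := exists_measure_osc_le hh hih K hη0
  obtain ⟨δ₂, hδ₂, h₂⟩ := exists_measure_osc_le hl hil K hη0
  refine ⟨min (min δ₁ δ₂) (η / (c - mh - ml)),
    lt_min (lt_min hδ₁ hδ₂) (div_pos hη0 hcpos), fun n => ?_⟩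
  -- Lowering the threshold by `n G` makes the Chernoff exponent exactly `K`.
  set a : ℝ := n * (x * (b + c * t) + y * (b + c * (t - s)) - G) with ha
  have h₃ := measure_linear_le hh hl hindep x y s t a n
  rw [← hQ, show n * ((x + y) * (mh + ml) * t - y * mh * s + Q / 2) - a = -(n * K) by
    rw [ha, hG]; ring] at h₃
  have hthree : (3 : ℝ≥0∞) * ENNReal.ofReal (Real.exp (-(n * K))) =
      ENNReal.ofReal (Real.exp (-(n * K))) + ENNReal.ofReal (Real.exp (-(n * K))) +
        ENNReal.ofReal (Real.exp (-(n * K))) := by ring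
  rw [hthree]
  refine le_trans (measure_mono ?_) ((measure_union_le _ _).trans
    (add_le_add ((measure_union_le _ _).trans (add_le_add (h₁ (-t) n) (h₂ (-t) n))) h₃))
  rintro ω ⟨r, hr, hr0, hover, hovers⟩
  by_contra! hcon
  simp only [Set.mem_union, Set.mem_ofPred_eq, not_or, not_exists, not_and, not_lt, not_le]
    at hcon
  obtain ⟨⟨o₁, o₂⟩, o₃⟩ := hcon
  have hr' : |t - r| < min (min δ₁ δ₂) (η / (c - mh - ml)) := by rwa [abs_sub_comm]
  have d₁ := o₁ (t - r) (hr'.trans_le ((min_le_left _ _).trans (min_le_left _ _)))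
  have d₂ := o₂ (t - r) (hr'.trans_le ((min_le_left _ _).trans (min_le_right _ _)))
  have d₃ : (c - mh - ml) * (t - r) ≤ η := by
    have := (le_abs_self _).trans (hr'.le.trans (min_le_right _ _))
    rwa [le_div_iff₀ hcpos, mul_comm] at this
  rw [show -t + (t - r) = -r by ring] at d₁ d₂
  have hn0 : (0 : ℝ) ≤ n := Nat.cast_nonneg n
  have e : ∑ i ∈ Finset.range n, (y * Ah i (-s) ω - (x + y) * Ah i (-t) ω -
        (x + y) * Al i (-t) ω) =
      x * ∑ i ∈ Finset.range n, (-Ah i (-r) ω - Al i (-r) ω) +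
      y * ∑ i ∈ Finset.range n, (Ah i (-s) ω - Ah i (-r) ω - Al i (-r) ω) +
      (x + y) * ∑ i ∈ Finset.range n, (Ah i (-r) ω - Ah i (-t) ω - mh * (t - r)) +
      (x + y) * ∑ i ∈ Finset.range n, (Al i (-r) ω - Al i (-t) ω - ml * (t - r)) +
      n * ((x + y) * ((mh + ml) * (t - r))) := by
    simp only [Finset.mul_sum]
    rw [← Finset.sum_add_distrib, ← Finset.sum_add_distrib, ← Finset.sum_add_distrib]
    have : (n : ℝ) * ((x + y) * ((mh + ml) * (t - r))) =
        ∑ i ∈ Finset.range n, (x + y) * ((mh + ml) * (t - r)) := by simp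
    rw [this, ← Finset.sum_add_distrib]
    exact Finset.sum_congr rfl fun i _ => by ring
  rw [e] at o₃
  have f₁ := mul_le_mul_of_nonneg_left hover.le hx
  have f₂ := mul_le_mul_of_nonneg_left (hovers s hs).le hy
  have f₃ := mul_le_mul_of_nonneg_left (abs_le.1 d₁).1 (add_nonneg hx hy)
  have f₄ := mul_le_mul_of_nonneg_left (abs_le.1 d₂).1 (add_nonneg hx hy)
  have f₅ := mul_le_mul_of_nonneg_left (mul_le_mul_of_nonneg_left d₃ (add_nonneg hx hy)) hn0
  have f₆ := mul_le_mul_of_nonneg_left hηG hn0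
  rw [ha] at o₃
  linarith

/-- The exponential upper bound for the low-priority overflow probability. -/
lemma exists_measure_lowQueue_le (hb : 0 < b) (hc : mh + ml < c) {K : ℝ}
    (hK : ENNReal.ofReal K < ⨅ (t : ℝ) (_ : 0 < t), ⨆ (s : ℝ) (_ : 0 < s),
      ⨅ f ∈ overflowSet mh ml b c s t, pairRate vh vl mh ml f) :
    ∃ C : ℝ≥0∞, C ≠ ⊤ ∧ ∀ n : ℕ, 1 ≤ n →
      P {ω | ((n * b : ℝ) : EReal) < lowQueue Ah Al c n ω} ≤
        C * ENNReal.ofReal (Real.exp (-(n * K))) := by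
  obtain ⟨T, C₁, hC₁, h₁⟩ := exists_measure_overflow_tail_le hh hl hindep hb hc K
  have hcompact : ∃ C : ℝ≥0∞, C ≠ ⊤ ∧ ∀ n : ℕ, 1 ≤ n →
      P {ω | ∃ t ∈ Set.Icc 0 T, 0 < t ∧ LowOverflowAt Ah Al b c n t ω} ≤
        C * ENNReal.ofReal (Real.exp (-(n * K))) := by
    -- The bound with an unspecified finite constant is stable under finite unions, so it only has
    -- to be checked locally.
    refine isCompact_Icc.induction_on (p := fun S => ∃ C : ℝ≥0∞, C ≠ ⊤ ∧ ∀ n : ℕ, 1 ≤ n →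
      P {ω | ∃ t ∈ S, 0 < t ∧ LowOverflowAt Ah Al b c n t ω} ≤
        C * ENNReal.ofReal (Real.exp (-(n * K)))) ?_ ?_ ?_ ?_
    · exact ⟨0, by simp, by simp⟩
    · rintro S S' hSS' ⟨C, hC, h⟩
      refine ⟨C, hC, fun n hn => (measure_mono ?_).trans (h n hn)⟩
      rintro ω ⟨t, ht, hω⟩
      exact ⟨t, hSS' ht, hω⟩
    · rintro S S' ⟨C, hC, h⟩ ⟨C', hC', h'⟩
      refine ⟨C + C', ENNReal.add_ne_top.2 ⟨hC, hC'⟩, fun n hn => ?_⟩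
      rw [add_mul]
      refine le_trans (measure_mono ?_) ((measure_union_le _ _).trans
        (add_le_add (h n hn) (h' n hn)))
      rintro ω ⟨t, ht | ht, hω⟩
      · exact Or.inl ⟨t, ht, hω⟩
      · exact Or.inr ⟨t, ht, hω⟩
    · intro t ht
      rcases ht.1.eq_or_lt with rfl | ht0
      · obtain ⟨δ, hδ, h⟩ := exists_measure_overflow_near_zero_le hh hl hindep hb hc K
        refine ⟨Metric.ball 0 δ, mem_nhdsWithin_of_mem_nhds (Metric.ball_mem_nhds _ hδ), 2,
          by norm_num, fun n _ => (measure_mono ?_).trans (h n)⟩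
        rintro ω ⟨t, ht, hω⟩
        exact ⟨t, by simpa [Real.dist_eq] using ht, hω⟩
      · obtain ⟨δ, hδ, h⟩ := exists_measure_overflow_near_le hh hl hindep hb hc ht0
          (hK.trans_le (iInf₂_le t ht0))
        refine ⟨Metric.ball t δ, mem_nhdsWithin_of_mem_nhds (Metric.ball_mem_nhds _ hδ), 3,
          by norm_num, fun n _ => (measure_mono ?_).trans (h n)⟩
        rintro ω ⟨r, hr, hω⟩
        exact ⟨r, by simpa [Real.dist_eq] using hr, hω⟩
  obtain ⟨C₂, hC₂, h₂⟩ := hcompact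
  refine ⟨C₁ + C₂, ENNReal.add_ne_top.2 ⟨hC₁, hC₂⟩, fun n hn => ?_⟩
  rw [add_mul]
  refine le_trans (measure_mono_ae ?_) ((measure_union_le _ _).trans
    (add_le_add (h₁ n hn) (h₂ n hn)))
  filter_upwards [ae_exists_lowOverflowAt hh hl n] with ω hω hlt
  obtain ⟨t, ht0, hover⟩ := hω hlt
  rcases le_total T t with hT | hT
  · exact Or.inl ⟨t, hT, hover⟩
  · exact Or.inr ⟨t, ⟨ht0.le, hT⟩, ht0, hover⟩

end Bounds

end Overflow

/-! ### Passage to the decay rate -/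

lemma le_liminf_neg_log_div {p : ℕ → ℝ≥0∞} {K : ℝ}
    (h : ∀ᶠ n : ℕ in atTop, p n ≤ ENNReal.ofReal (Real.exp (-(n * K)))) :
    (K : EReal) ≤ liminf (fun n : ℕ => -(ENNReal.log (p n)) / (n : EReal)) atTop := by
  refine le_liminf_of_le (by isBoundedDefault) ?_
  filter_upwards [h, eventually_gt_atTop 0] with n hn hpos
  have hcast : (n : EReal) = ((n : ℝ) : EReal) := (EReal.coe_natCast).symm
  rw [hcast, EReal.le_div_iff_mul_le (by exact_mod_cast hpos) (EReal.coe_ne_top _), EReal.le_neg]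
  refine (ENNReal.log_monotone hn).trans_eq ?_
  rw [ENNReal.log_ofReal_of_pos (Real.exp_pos _), Real.log_exp, ← EReal.coe_mul, ← EReal.coe_neg,
    mul_comm]

end PriorityQueue

theorem theorem5p2 {Ω : Type*} [MeasurableSpace Ω] (P : Measure Ω) [IsProbabilityMeasure P]
    (Ah Al : ℕ → ℝ → Ω → ℝ) (mh ml b c : ℝ) (vh vl : ℝ → ℝ)
    (hh : ∀ i, PriorityQueue.IsGaussianSource P (Ah i) mh vh)
    (hl : ∀ i, PriorityQueue.IsGaussianSource P (Al i) ml vl)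
    -- all the high-priority and low-priority sources are mutually independent processes
    (hindep : iIndepFun (fun (k : ℕ ⊕ ℕ) (ω : Ω) (t : ℝ) => Sum.elim Ah Al k t ω) P)
    (hb : 0 < b) (hc : mh + ml < c) :
    ((⨅ (t : ℝ) (_ : 0 < t), ⨆ (s : ℝ) (_ : 0 < s),
        ⨅ f ∈ PriorityQueue.overflowSet mh ml b c s t,
          PriorityQueue.pairRate vh vl mh ml f : ℝ≥0∞) : EReal) ≤
      PriorityQueue.lowDecayRate P Ah Al b c := by
  refine le_of_forall_lt fun z hz => ?_
  obtain ⟨r, hzr, hr⟩ := EReal.lt_iff_exists_real_btwn.1 hz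
  refine hzr.trans_le (PriorityQueue.le_liminf_neg_log_div ?_)
  -- Negative levels are separated because `ENNReal.ofReal` would truncate them; there the trivial
  -- bound `1` suffices.
  rcases lt_or_ge r 0 with hr0 | hr0
  · refine Eventually.of_forall fun n => prob_le_one.trans ?_
    rw [← ENNReal.ofReal_one, ← Real.exp_zero]
    refine ENNReal.ofReal_le_ofReal (Real.exp_le_exp.2 ?_)
    nlinarith [(Nat.cast_nonneg n : (0 : ℝ) ≤ n)]
  -- The gap `K - r` absorbs the constant `C`, since eventually `C ≤ exp (n (K - r))`.
  obtain ⟨K, hrK, hK⟩ := EReal.lt_iff_exists_real_btwn.1 hr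
  rw [EReal.coe_lt_coe_iff] at hrK
  have hK0 : 0 ≤ K := hr0.trans hrK.le
  rw [show (K : EReal) = (ENNReal.ofReal K : EReal) by
    rw [EReal.coe_ennreal_ofReal, max_eq_left hK0], EReal.coe_ennreal_lt_coe_ennreal_iff] at hK
  obtain ⟨C, hC, h⟩ := PriorityQueue.exists_measure_lowQueue_le hh hl hindep hb hc hK
  have hlim : Tendsto (fun n : ℕ => (n : ℝ) * (K - r)) atTop atTop :=
    tendsto_natCast_atTop_atTop.atTop_mul_const (sub_pos.2 hrK)
  filter_upwards [eventually_ge_atTop 1, hlim.eventually_ge_atTop C.toReal] with n hn hCn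
  refine (h n hn).trans ?_
  rw [← ENNReal.ofReal_toReal hC, ← ENNReal.ofReal_mul ENNReal.toReal_nonneg]
  refine ENNReal.ofReal_le_ofReal ?_
  calc C.toReal * Real.exp (-(n * K))
      ≤ Real.exp (n * (K - r)) * Real.exp (-(n * K)) := by
        gcongr
        linarith [Real.add_one_le_exp (n * (K - r))]
    _ = Real.exp (-(n * r)) := by
        rw [← Real.exp_add]
        ring_nf
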